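/- For $q\in[0,1]$ let $SU_q(2)$ be the universal unital $C^*$-algebra generated by two elements $\alpha,\gamma$ subject to the relation that the matrix $$\begin{pmatrix}\alpha & -q\gamma^*\\ \gamma & \alpha^*\end{pmatrix}$$ is unitary, and let $\otimes$ denote the minimal (spatial) tensor product of $C^*$-algebras. Then there is a unital $*$-homomorphism $\Delta: SU_q(2)\to SU_q(2)\otimes SU_q(2)$ with $$\Delta(\alpha)=\alpha\otimes\alpha-q\,\gamma^*\otimes\gamma,\qquad \Delta(\gamma)=\gamma\otimes\alpha+\alpha^*\otimes\gamma,$$ and it is coassociative: $(\Delta\otimes \mathrm{id})\Delta=(\mathrm{id}\otimes\Delta)\Delta$ (under the canonical identification of the two threefold tensor products). If moreover $q>0$, then the linear spans of $$\{\Delta(a)(1\otimes b): a,b\in SU_q(2)\}\quad\text{and}\quad \{\Delta(a)(b\otimes 1): a,b\in SU_q(2)\}$$ are both dense in $SU_q(2)\otimes SU_q(2)$; that is, $(SU_q(2),\Delta)$ is a compact quantum group. -/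

import Mathlib

open scoped TensorProduct

noncomputable section

universe u v

/-! ### C*-seminorms and the C*-algebras they define -/

/-- A C*-seminorm on a unital complex *-algebra. -/
structure CStarSeminorm (A : Type u) [Ring A] [StarRing A] [Algebra ℂ A] extends
    Seminorm ℂ A where
  mul_le' : ∀ x y, toFun (x * y) ≤ toFun x * toFun y
  star_mul_self' : ∀ x, toFun (star x * x) = toFun x * toFun x

namespace CStarSeminorm

section Basic

variable {A : Type u} [Ring A] [StarRing A] [Algebra ℂ A]

instance : CoeFun (CStarSeminorm A) (fun _ => A → ℝ) := ⟨fun p => p.toSeminorm⟩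

theorem mul_le (p : CStarSeminorm A) (x y : A) : p (x * y) ≤ p x * p y := p.mul_le' x y

theorem star_mul_self (p : CStarSeminorm A) (x : A) : p (star x * x) = p x * p x :=
  p.star_mul_self' x

theorem nonneg (p : CStarSeminorm A) (x : A) : 0 ≤ p x := apply_nonneg p.toSeminorm x

theorem le_star (p : CStarSeminorm A) (x : A) : p x ≤ p (star x) := by
  rcases (p.nonneg x).eq_or_lt with h | h
  · rw [← h]; exact p.nonneg _
  · have := p.mul_le (star x) x
    rw [p.star_mul_self] at this
    exact le_of_mul_le_mul_right this h

theorem map_star (p : CStarSeminorm A) (x : A) : p (star x) = p x :=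
  le_antisymm (by simpa using p.le_star (star x)) (p.le_star x)

/-- The pointwise supremum of a pointwise bounded set of C*-seminorms. -/
def sup (S : Set (CStarSeminorm A)) (hS : ∀ x, ∃ M : ℝ, ∀ p ∈ S, p x ≤ M) :
    CStarSeminorm A where
  toFun x := ⨆ p : S, p.1 x
  map_zero' := by
    have : ∀ p : S, p.1 (0 : A) = 0 := fun p => map_zero p.1.toSeminorm
    simp [this]
  add_le' x y := by
    have hb : ∀ z, BddAbove (Set.range fun p : S => p.1 z) := fun z => by
      obtain ⟨M, hM⟩ := hS z
      exact ⟨M, by rintro _ ⟨p, rfl⟩; exact hM p.1 p.2⟩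
    have h0 : ∀ z, 0 ≤ ⨆ p : S, p.1 z := fun z => Real.iSup_nonneg fun p => p.1.nonneg z
    refine Real.iSup_le (fun p => ?_) (add_nonneg (h0 x) (h0 y))
    exact (map_add_le_add p.1.toSeminorm x y).trans
      (add_le_add (le_ciSup (hb x) p) (le_ciSup (hb y) p))
  neg' x := by
    have : ∀ p : S, p.1 (-x) = p.1 x := fun p => map_neg_eq_map p.1.toSeminorm x
    simp [this]
  smul' c x := by
    have : ∀ p : S, p.1 (c • x) = ‖c‖ * p.1 x := fun p => map_smul_eq_mul p.1.toSeminorm c x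
    simp only [this]
    exact (Real.mul_iSup_of_nonneg (norm_nonneg c) _).symm
  mul_le' x y := by
    have hb : ∀ z, BddAbove (Set.range fun p : S => p.1 z) := fun z => by
      obtain ⟨M, hM⟩ := hS z
      exact ⟨M, by rintro _ ⟨p, rfl⟩; exact hM p.1 p.2⟩
    have h0 : ∀ z, 0 ≤ ⨆ p : S, p.1 z := fun z => Real.iSup_nonneg fun p => p.1.nonneg z
    refine Real.iSup_le (fun p => ?_) (mul_nonneg (h0 x) (h0 y))
    exact (p.1.mul_le x y).trans
      (mul_le_mul (le_ciSup (hb x) p) (le_ciSup (hb y) p) (p.1.nonneg y) (h0 x))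
  star_mul_self' x := by
    have hb : ∀ z, BddAbove (Set.range fun p : S => p.1 z) := fun z => by
      obtain ⟨M, hM⟩ := hS z
      exact ⟨M, by rintro _ ⟨p, rfl⟩; exact hM p.1 p.2⟩
    have h0 : ∀ z, 0 ≤ ⨆ p : S, p.1 z := fun z => Real.iSup_nonneg fun p => p.1.nonneg z
    apply le_antisymm
    · refine Real.iSup_le (fun p => ?_) (mul_nonneg (h0 x) (h0 x))
      rw [p.1.star_mul_self]
      exact mul_le_mul (le_ciSup (hb x) p) (le_ciSup (hb x) p) (p.1.nonneg x) (h0 x)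
    · rw [← sq, ← Real.le_sqrt (h0 x)]
      refine Real.iSup_le (fun p => ?_) (Real.sqrt_nonneg _)
      refine Real.le_sqrt_of_sq_le ?_
      rw [sq, ← p.1.star_mul_self]
      exact le_ciSup (hb (star x * x)) p
      exact h0 _

/-- The algebra `A`, to be regarded as a seminormed algebra by means of `p`. -/
def Carrier (_p : CStarSeminorm A) : Type u := A

variable (p : CStarSeminorm A)

instance : Ring p.Carrier := inferInstanceAs (Ring A)

instance : StarRing p.Carrier := inferInstanceAs (StarRing A)

instance : Algebra ℂ p.Carrier := inferInstanceAs (Algebra ℂ A)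

instance : SeminormedRing p.Carrier where
  __ := (inferInstance : Ring p.Carrier)
  norm x := p x
  dist x y := p (show A from -x + y)
  dist_self x := by
    rw [neg_add_cancel]
    exact map_zero p.toSeminorm
  dist_comm x y := by
    have h : -x + y = -(-y + x) := by abel
    rw [h]
    exact map_neg_eq_map p.toSeminorm _
  dist_triangle x y z := by
    have h : -x + z = (-x + y) + (-y + z) := by abel
    rw [h]
    exact map_add_le_add p.toSeminorm _ _
  dist_eq _ _ := rfl
  norm_mul_le := p.mul_le

instance : NormedAlgebra ℂ p.Carrier where
  toAlgebra := (inferInstance : Algebra ℂ p.Carrier)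
  norm_smul_le c x := (map_smul_eq_mul p.toSeminorm c x).le

instance [StarModule ℂ A] : StarModule ℂ p.Carrier := inferInstanceAs (StarModule ℂ A)

theorem norm_def (x : p.Carrier) : ‖x‖ = p x := rfl

end Basic

section Completion

variable {A : Type u} [Ring A] [StarRing A] [Algebra ℂ A]

/-- The C*-algebra obtained from `A` by dividing out the null ideal of the C*-seminorm `p` and
completing in the resulting norm. -/
def Completion (p : CStarSeminorm A) : Type u := UniformSpace.Completion p.Carrier

variable (p : CStarSeminorm A)

instance : NormedRing p.Completion := inferInstanceAs (NormedRing (UniformSpace.Completion p.Carrier))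

instance : Algebra ℂ p.Completion := inferInstanceAs (Algebra ℂ (UniformSpace.Completion p.Carrier))

instance : NormedAlgebra ℂ p.Completion where
  norm_smul_le := norm_smul_le (α := ℂ) (β := UniformSpace.Completion p.Carrier)

instance : CompleteSpace p.Completion :=
  inferInstanceAs (CompleteSpace (UniformSpace.Completion p.Carrier))

theorem isometry_star : Isometry (star : p.Carrier → p.Carrier) :=
  AddMonoidHomClass.isometry_of_norm (starAddEquiv : p.Carrier ≃+ p.Carrier) p.map_star

/-- The canonical map from `A` to its completion with respect to `p`. -/
def of (x : A) : p.Completion := (show p.Carrier from x : UniformSpace.Completion p.Carrier)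

instance : Star p.Completion := ⟨UniformSpace.Completion.map (star : p.Carrier → p.Carrier)⟩

theorem star_of (x : A) : star (p.of x) = p.of (star x) :=
  UniformSpace.Completion.map_coe p.isometry_star.uniformContinuous x

theorem continuous_star_completion : Continuous (star : p.Completion → p.Completion) :=
  UniformSpace.Completion.continuous_map

theorem completion_induction {P : p.Completion → Prop} (x : p.Completion) (hc : IsClosed {x | P x})
    (h : ∀ a : A, P (p.of a)) : P x :=
  UniformSpace.Completion.induction_on x hc h

theorem of_add (x y : A) : p.of (x + y) = p.of x + p.of y :=
  UniformSpace.Completion.coe_add (α := p.Carrier) x y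

theorem of_mul (x y : A) : p.of (x * y) = p.of x * p.of y :=
  UniformSpace.Completion.coe_mul (α := p.Carrier) x y

theorem of_smul (c : ℂ) (x : A) : p.of (c • x) = c • p.of x :=
  UniformSpace.Completion.coe_smul (X := p.Carrier) c x

theorem of_one : p.of 1 = 1 := UniformSpace.Completion.coe_one p.Carrier

theorem norm_of (x : A) : ‖p.of x‖ = p x :=
  UniformSpace.Completion.norm_coe (E := p.Carrier) x

instance [StarModule ℂ A] : CStarAlgebra p.Completion where
  star_involutive x := by
    have hs := p.continuous_star_completion
    refine p.completion_induction (P := fun x => star (star x) = x) x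
      (isClosed_eq (hs.comp hs) continuous_id) fun a => ?_
    rw [star_of, star_of, star_star]
  star_mul x y := by
    have hs := p.continuous_star_completion
    refine p.completion_induction (P := fun x => star (x * y) = star y * star x) x
      (isClosed_eq (hs.comp (continuous_id.mul continuous_const)) (continuous_const.mul hs))
      fun a => ?_
    refine p.completion_induction (P := fun y => star (p.of a * y) = star y * star (p.of a)) y
      (isClosed_eq (hs.comp (continuous_const.mul continuous_id)) (hs.mul continuous_const))
      fun b => ?_
    rw [← of_mul, star_of, star_of, star_of, star_mul, of_mul]
  star_add x y := by
    have hs := p.continuous_star_completion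
    refine p.completion_induction (P := fun x => star (x + y) = star x + star y) x
      (isClosed_eq (hs.comp (continuous_id.add continuous_const)) (hs.add continuous_const))
      fun a => ?_
    refine p.completion_induction (P := fun y => star (p.of a + y) = star (p.of a) + star y) y
      (isClosed_eq (hs.comp (continuous_const.add continuous_id)) (continuous_const.add hs))
      fun b => ?_
    rw [← of_add, star_of, star_of, star_of, star_add, of_add]
  norm_mul_self_le x := by
    have hs := p.continuous_star_completion
    refine p.completion_induction (P := fun x => ‖x‖ * ‖x‖ ≤ ‖star x * x‖) x
      (isClosed_le (continuous_norm.mul continuous_norm)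
        (continuous_norm.comp (hs.mul continuous_id))) fun a => ?_
    rw [star_of, ← of_mul, norm_of, norm_of, p.star_mul_self]
  star_smul c x := by
    have hs := p.continuous_star_completion
    refine p.completion_induction (P := fun x => star (c • x) = star c • star x) x
      (isClosed_eq (hs.comp (continuous_const_smul c))
        ((continuous_const_smul (star c)).comp hs)) fun a => ?_
    rw [← of_smul, star_of, star_of, star_smul, of_smul]

end Completion

end CStarSeminorm

/-! ### The minimal tensor product of C*-algebras -/

section MinTensor

/-- The C*-seminorm `x ↦ ‖T x‖` of a *-representation `T` of a *-algebra by bounded operators on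
a pre-Hilbert space. -/
def repSeminorm {R : Type u} [Ring R] [StarRing R] [Algebra ℂ R]
    {E : Type v} [NormedAddCommGroup E] [InnerProductSpace ℂ E] (T : R →ₗ[ℂ] (E →L[ℂ] E))
    (hmul : ∀ x y, T (x * y) = T x * T y)
    (hinner : ∀ x v w, inner ℂ (T (star x) v) w = inner ℂ v (T x w)) : CStarSeminorm R where
  toFun x := ‖T x‖
  map_zero' := by simp
  add_le' x y := by rw [map_add]; exact norm_add_le _ _
  neg' x := by rw [map_neg, norm_neg]
  smul' c x := by rw [map_smul, norm_smul]
  mul_le' x y := by rw [hmul]; exact norm_mul_le _ _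
  star_mul_self' x := by
    have key : ∀ y : R,
        ‖T y‖ * ‖T y‖ ≤ ‖T (star y * y)‖ := fun y => by
      rw [← sq, ← Real.le_sqrt (norm_nonneg _)]
      refine ContinuousLinearMap.opNorm_le_bound _ (Real.sqrt_nonneg _) fun v => ?_
      rw [← Real.sqrt_sq (norm_nonneg v), ← Real.sqrt_mul (norm_nonneg _)]
      refine Real.le_sqrt_of_sq_le ?_
      have h1 : ‖T y v‖ ^ 2 = ‖inner ℂ (T (star y * y) v) v‖ := by
        rw [hmul, mul_apply_eq_comp, hinner,
          inner_self_eq_norm_sq_to_K]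
        simp
      rw [h1]
      calc _ ≤ ‖T (star y * y) v‖ * ‖v‖ := norm_inner_le_norm _ _
        _ ≤ ‖T (star y * y)‖ * ‖v‖ * ‖v‖ := by
            gcongr
            exact ContinuousLinearMap.le_opNorm _ _
        _ = _ := by ring
      exact norm_nonneg _
    have hle : ∀ y : R, ‖T y‖ ≤ ‖T (star y)‖ := fun y => by
      rcases (norm_nonneg (T y)).eq_or_lt with h | h
      · rw [← h]; exact norm_nonneg _
      · have h2 := key y
        rw [hmul] at h2
        exact le_of_mul_le_mul_right (h2.trans (norm_mul_le _ _)) h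
    refine le_antisymm ?_ (key x)
    rw [hmul]
    refine (norm_mul_le _ _).trans (mul_le_mul_of_nonneg_right ?_ (norm_nonneg _))
    simpa using hle (star x)

/-- For representations `π` of `A` on `H` and `ρ` of `B` on `K`, the representation `π ⊗ ρ` of
the algebraic tensor product `A ⊗ B`, determined by `a ⊗ b ↦ π a ⊗ ρ b`, acting by bounded
operators on the algebraic tensor product `H ⊗ K` with its pre-Hilbert space structure (a dense
subspace of the Hilbert space tensor product, so that operator norms are the same on both). -/
def tensorRep {A : Type u} {B : Type v} [CStarAlgebra A] [CStarAlgebra B]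
    {H : Type u} [NormedAddCommGroup H] [InnerProductSpace ℂ H] [CompleteSpace H]
    {K : Type v} [NormedAddCommGroup K] [InnerProductSpace ℂ K] [CompleteSpace K]
    (π : A →⋆ₐ[ℂ] (H →L[ℂ] H)) (ρ : B →⋆ₐ[ℂ] (K →L[ℂ] K)) :
    A ⊗[ℂ] B →ₗ[ℂ] (H ⊗[ℂ] K →L[ℂ] H ⊗[ℂ] K) :=
  TensorProduct.lift
    (LinearMap.mk₂ ℂ (fun a b => TensorProduct.mapL (π a) (ρ b))
      (fun a a' b => by rw [map_add, TensorProduct.mapL_add_left])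
      (fun c a b => by rw [map_smul, TensorProduct.mapL_smul_left])
      (fun a b b' => by rw [map_add, TensorProduct.mapL_add_right])
      (fun c a b => by rw [map_smul, TensorProduct.mapL_smul_right]))

section

variable {A : Type u} {B : Type v} [CStarAlgebra A] [CStarAlgebra B]
  {H : Type u} [NormedAddCommGroup H] [InnerProductSpace ℂ H] [CompleteSpace H]
  {K : Type v} [NormedAddCommGroup K] [InnerProductSpace ℂ K] [CompleteSpace K]
  (π : A →⋆ₐ[ℂ] (H →L[ℂ] H)) (ρ : B →⋆ₐ[ℂ] (K →L[ℂ] K))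

theorem tensorRep_tmul (a : A) (b : B) :
    tensorRep π ρ (a ⊗ₜ[ℂ] b) = TensorProduct.mapL (π a) (ρ b) := rfl

theorem tensorRep_mul (x y : A ⊗[ℂ] B) :
    tensorRep π ρ (x * y) = tensorRep π ρ x * tensorRep π ρ y := by
  induction x using TensorProduct.induction_on with
  | zero => simp
  | add x x' hx hx' => rw [add_mul, map_add, map_add, add_mul, hx, hx']
  | tmul a b =>
    induction y using TensorProduct.induction_on with
    | zero => simp
    | add y y' hy hy' => rw [mul_add, map_add, map_add, mul_add, hy, hy']
    | tmul a' b' =>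
      rw [Algebra.TensorProduct.tmul_mul_tmul, tensorRep_tmul, tensorRep_tmul, tensorRep_tmul,
        map_mul, map_mul, TensorProduct.mapL_mul]

theorem inner_tensorRep (x : A ⊗[ℂ] B) (v w : H ⊗[ℂ] K) :
    inner ℂ (tensorRep π ρ (star x) v) w = inner ℂ v (tensorRep π ρ x w) := by
  induction x using TensorProduct.induction_on with
  | zero => simp
  | add x x' hx hx' =>
    rw [star_add, map_add, map_add, add_apply, add_apply,
      inner_add_left, inner_add_right, hx, hx']
  | tmul a b =>
    rw [TensorProduct.star_tmul, tensorRep_tmul, tensorRep_tmul, map_star, map_star]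
    induction v using TensorProduct.induction_on with
    | zero => simp
    | add v v' hv hv' => rw [map_add, inner_add_left, inner_add_left, hv, hv']
    | tmul h k =>
      induction w using TensorProduct.induction_on with
      | zero => simp
      | add w w' hw hw' => rw [map_add, inner_add_right, inner_add_right, hw, hw']
      | tmul h' k' =>
        rw [TensorProduct.mapL_tmul, TensorProduct.mapL_tmul, TensorProduct.inner_tmul,
          TensorProduct.inner_tmul, ContinuousLinearMap.star_eq_adjoint,
          ContinuousLinearMap.star_eq_adjoint, ContinuousLinearMap.adjoint_inner_left,
          ContinuousLinearMap.adjoint_inner_left]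

/-- The C*-seminorm `x ↦ ‖(π ⊗ ρ) x‖` on the algebraic tensor product. -/
def tensorRepSeminorm : CStarSeminorm (A ⊗[ℂ] B) :=
  repSeminorm (E := H ⊗[ℂ] K) (tensorRep π ρ) (tensorRep_mul π ρ) (inner_tensorRep π ρ)

theorem tensorRepSeminorm_apply (x : A ⊗[ℂ] B) : tensorRepSeminorm π ρ x = ‖tensorRep π ρ x‖ := rfl

end

variable (A : Type u) (B : Type v) [CStarAlgebra A] [CStarAlgebra B]

/-- The C*-seminorms on `A ⊗ B` of the form `x ↦ ‖(π ⊗ ρ) x‖` for (unital) representations `π` of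
`A` and `ρ` of `B` on Hilbert spaces. -/
def spatialSeminorms : Set (CStarSeminorm (A ⊗[ℂ] B)) :=
  {p | ∃ (H : Type u) (_ : NormedAddCommGroup H) (_ : InnerProductSpace ℂ H) (_ : CompleteSpace H)
    (K : Type v) (_ : NormedAddCommGroup K) (_ : InnerProductSpace ℂ K) (_ : CompleteSpace K)
    (π : A →⋆ₐ[ℂ] (H →L[ℂ] H)) (ρ : B →⋆ₐ[ℂ] (K →L[ℂ] K)), p = tensorRepSeminorm π ρ}

theorem spatialSeminorms_bounded (x : A ⊗[ℂ] B) :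
    ∃ M : ℝ, ∀ p ∈ spatialSeminorms A B, p x ≤ M := by
  induction x using TensorProduct.induction_on with
  | zero => exact ⟨0, fun p _ => (map_zero p.toSeminorm).le⟩
  | add x y hx hy =>
    obtain ⟨M, hM⟩ := hx
    obtain ⟨N, hN⟩ := hy
    exact ⟨M + N, fun p hp =>
      (map_add_le_add p.toSeminorm x y).trans (add_le_add (hM p hp) (hN p hp))⟩
  | tmul a b =>
    refine ⟨‖a‖ * ‖b‖, ?_⟩
    rintro p ⟨H, _, _, _, K, _, _, _, π, ρ, rfl⟩
    rw [tensorRepSeminorm_apply, tensorRep_tmul]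
    refine (TensorProduct.norm_mapL_le _ _).trans ?_
    gcongr
    · exact NonUnitalStarAlgHom.norm_apply_le π a
    · exact NonUnitalStarAlgHom.norm_apply_le ρ b

/-- The minimal (spatial) C*-norm on `A ⊗ B`: the supremum of `‖(π ⊗ ρ) x‖` over all
representations `π` of `A` and `ρ` of `B`. -/
def minSeminorm : CStarSeminorm (A ⊗[ℂ] B) :=
  CStarSeminorm.sup (spatialSeminorms A B) (spatialSeminorms_bounded A B)

/-- The minimal (spatial) tensor product of two unital C*-algebras. -/
def MinTensor : Type (max u v) := (minSeminorm A B).Completion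

instance : CStarAlgebra (MinTensor A B) := inferInstanceAs (CStarAlgebra (minSeminorm A B).Completion)

variable {A B}

/-- The elementary tensor `a ⊗ b` in the minimal tensor product. -/
def minTmul (a : A) (b : B) : MinTensor A B := (minSeminorm A B).of (a ⊗ₜ[ℂ] b)

end MinTensor

/-! ### Compact quantum groups -/

section CompactQuantumGroup

variable {A : Type u} [CStarAlgebra A]

/-- Coassociativity `(Δ ⊗ id) Δ = (id ⊗ Δ) Δ` of a unital *-homomorphism `Δ : A → A ⊗ A`. The
*-homomorphisms `Δ ⊗ id` and `id ⊗ Δ` and the canonical *-isomorphism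
`(A ⊗ A) ⊗ A ≃ A ⊗ (A ⊗ A)` are pinned by their values on elementary tensors, which span dense
subspaces. -/
def IsCoassociative (Δ : A →⋆ₐ[ℂ] MinTensor A A) : Prop :=
  ∃ (Δid : MinTensor A A →⋆ₐ[ℂ] MinTensor (MinTensor A A) A)
    (idΔ : MinTensor A A →⋆ₐ[ℂ] MinTensor A (MinTensor A A))
    (assoc : MinTensor (MinTensor A A) A ≃⋆ₐ[ℂ] MinTensor A (MinTensor A A)),
    (∀ a b, Δid (minTmul a b) = minTmul (Δ a) b) ∧
    (∀ a b, idΔ (minTmul a b) = minTmul a (Δ b)) ∧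
    (∀ a b c, assoc (minTmul (minTmul a b) c) = minTmul a (minTmul b c)) ∧
    ∀ a, assoc (Δid (Δ a)) = idΔ (Δ a)

/-- `(A, Δ)` is a compact quantum group: `A` is a unital C*-algebra, `Δ : A → A ⊗ A` is a
coassociative unital *-homomorphism, and the linear spans of `Δ(A)(1 ⊗ A)` and `Δ(A)(A ⊗ 1)` are
dense in `A ⊗ A`. -/
structure IsCompactQuantumGroup (Δ : A →⋆ₐ[ℂ] MinTensor A A) : Prop where
  coassoc : IsCoassociative Δ
  dense_right : Dense (Submodule.span ℂ
    {x : MinTensor A A | ∃ a b : A, x = Δ a * minTmul 1 b} : Set (MinTensor A A))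
  dense_left : Dense (Submodule.span ℂ
    {x : MinTensor A A | ∃ a b : A, x = Δ a * minTmul b 1} : Set (MinTensor A A))

end CompactQuantumGroup

/-! ### The free unital *-algebra on two generators -/

/-- The free unital *-algebra on two generators `a` and `c`: the algebra of noncommutative
polynomials in `a, c, a*, c*`. The letter `(i, false)` stands for the `i`-th generator and
`(i, true)` for its adjoint. -/
def FreeStarAlg : Type := MonoidAlgebra ℂ (FreeMonoid (Fin 2 × Bool))

namespace FreeStarAlg

instance : Ring FreeStarAlg := inferInstanceAs (Ring (MonoidAlgebra ℂ (FreeMonoid (Fin 2 × Bool))))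

instance : Algebra ℂ FreeStarAlg :=
  inferInstanceAs (Algebra ℂ (MonoidAlgebra ℂ (FreeMonoid (Fin 2 × Bool))))

/-- The monomial of a word. -/
def mono : FreeMonoid (Fin 2 × Bool) →* FreeStarAlg :=
  MonoidAlgebra.of ℂ (FreeMonoid (Fin 2 × Bool))

/-- The adjoint of a word: reverse it and exchange each letter with its adjoint. -/
def wordStar (m : FreeMonoid (Fin 2 × Bool)) : FreeMonoid (Fin 2 × Bool) :=
  star (FreeMonoid.map (fun x => (x.1, !x.2)) m)

theorem wordStar_mul (m n : FreeMonoid (Fin 2 × Bool)) :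
    wordStar (m * n) = wordStar n * wordStar m := by
  rw [wordStar, map_mul, star_mul]; rfl

theorem wordStar_wordStar (m : FreeMonoid (Fin 2 × Bool)) : wordStar (wordStar m) = m := by
  induction m using FreeMonoid.recOn with
  | one => rfl
  | of_mul x xs ih =>
    rw [wordStar_mul, wordStar_mul, ih]
    congr 1
    change FreeMonoid.of (x.1, !!x.2) = FreeMonoid.of x
    rw [Bool.not_not]

/-- The adjoint of a polynomial: conjugate the coefficients and take adjoints of the words. -/
def starFun (f : FreeStarAlg) : FreeStarAlg :=
  MonoidAlgebra.mapDomain wordStar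
    (MonoidAlgebra.map ((starRingEnd ℂ : ℂ →+* ℂ) : ℂ →+ ℂ)
      (show MonoidAlgebra ℂ (FreeMonoid (Fin 2 × Bool)) from f))

/-- The term with coefficient `c` and word `m`. -/
def term (c : ℂ) (m : FreeMonoid (Fin 2 × Bool)) : FreeStarAlg := MonoidAlgebra.single m c

theorem induction {P : FreeStarAlg → Prop} (x : FreeStarAlg) (h0 : P 0)
    (hadd : ∀ x y, P x → P y → P (x + y)) (hterm : ∀ c m, P (term c m)) : P x :=
  MonoidAlgebra.induction_linear (motive := P) x h0 hadd fun m c => hterm c m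

theorem term_mul (c d : ℂ) (m n : FreeMonoid (Fin 2 × Bool)) :
    term c m * term d n = term (c * d) (m * n) :=
  MonoidAlgebra.single_mul_single ..

theorem smul_term (c d : ℂ) (m : FreeMonoid (Fin 2 × Bool)) : c • term d m = term (c * d) m :=
  MonoidAlgebra.smul_single ..

theorem starFun_term (c : ℂ) (m : FreeMonoid (Fin 2 × Bool)) :
    starFun (term c m) = term (starRingEnd ℂ c) (wordStar m) := by
  change MonoidAlgebra.mapDomain wordStar (MonoidAlgebra.map _ (MonoidAlgebra.single m c)) = _
  rw [MonoidAlgebra.map_single, MonoidAlgebra.mapDomain_single]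
  rfl

theorem starFun_zero : starFun 0 = 0 := by
  change MonoidAlgebra.mapDomain wordStar (MonoidAlgebra.map _ 0) = 0
  simp

theorem starFun_add (f g : FreeStarAlg) : starFun (f + g) = starFun f + starFun g := by
  refine Eq.trans (congrArg (MonoidAlgebra.mapDomain wordStar)
    (MonoidAlgebra.map_add ((starRingEnd ℂ : ℂ →+* ℂ) : ℂ →+ ℂ) f g)) ?_
  exact MonoidAlgebra.mapDomain_add ..

instance : StarRing FreeStarAlg where
  star := starFun
  star_involutive f := by
    refine induction (P := fun f => starFun (starFun f) = f) f ?_ ?_ ?_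
    · rw [starFun_zero, starFun_zero]
    · intro x y hx hy; rw [starFun_add, starFun_add, hx, hy]
    · intro c m; rw [starFun_term, starFun_term, wordStar_wordStar, Complex.conj_conj]
  star_add := starFun_add
  star_mul f g := by
    change starFun (f * g) = starFun g * starFun f
    refine induction (P := fun f => starFun (f * g) = starFun g * starFun f) f ?_ ?_ ?_
    · rw [zero_mul, starFun_zero, mul_zero]
    · intro x y hx hy; rw [add_mul, starFun_add, starFun_add, mul_add, hx, hy]
    intro c m
    refine induction
      (P := fun g => starFun (term c m * g) = starFun g * starFun (term c m)) g ?_ ?_ ?_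
    · rw [mul_zero, starFun_zero, zero_mul]
    · intro x y hx hy; rw [mul_add, starFun_add, starFun_add, add_mul, hx, hy]
    · intro d n
      rw [term_mul, starFun_term, starFun_term, starFun_term, term_mul, wordStar_mul, map_mul,
        mul_comm (starRingEnd ℂ c)]

theorem star_term (c : ℂ) (m : FreeMonoid (Fin 2 × Bool)) :
    star (term c m) = term (starRingEnd ℂ c) (wordStar m) := starFun_term c m

instance : StarModule ℂ FreeStarAlg where
  star_smul c f := by
    refine induction (P := fun f => star (c • f) = star c • star f) f ?_ ?_ ?_
    · rw [smul_zero, star_zero, smul_zero]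
    · intro x y hx hy; rw [smul_add, star_add, star_add, smul_add, hx, hy]
    · intro d m
      rw [smul_term, star_term, star_term, smul_term, map_mul]; rfl

/-- The `i`-th free generator. -/
def gen (i : Fin 2) : FreeStarAlg := term 1 (FreeMonoid.of (i, false))

theorem star_gen (i : Fin 2) : star (gen i) = term 1 (FreeMonoid.of (i, true)) := by
  rw [gen, star_term, map_one]; rfl

end FreeStarAlg

/-! ### The quantum group `SU_q(2)` -/

section SUq

/-- The matrix `[[a, -q c*], [c, a*]]`. -/
def suMatrix {B : Type u} [Ring B] [StarRing B] [Algebra ℂ B] (q : ℝ) (a c : B) :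
    Matrix (Fin 2) (Fin 2) B :=
  !![a, -((q : ℂ) • star c); c, star a]

open FreeStarAlg in
/-- The C*-seminorms on the free *-algebra in `a, c` under which the matrix
`U = [[a, -q c*], [c, a*]]` becomes unitary: all entries of `U* U - 1` and `U U* - 1` are null. -/
def suSeminorms (q : ℝ) : Set (CStarSeminorm FreeStarAlg) :=
  {p | ∀ i j,
    p (((suMatrix q (gen 0) (gen 1)).conjTranspose * suMatrix q (gen 0) (gen 1) - 1) i j) = 0 ∧
    p ((suMatrix q (gen 0) (gen 1) * (suMatrix q (gen 0) (gen 1)).conjTranspose - 1) i j) = 0}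

theorem norm_le_one_of_star_mul_add {B : Type u} [CStarAlgebra B] (h1 : ‖(1 : B)‖ ≤ 1) (a c : B)
    (h : star a * a + star c * c = 1) : ‖a‖ ≤ 1 := by
  let _ := CStarAlgebra.spectralOrder B
  have _ := CStarAlgebra.spectralOrderedRing B
  have h2 : star a * a ≤ 1 := by
    rw [← h]
    exact le_add_of_nonneg_right (star_mul_self_nonneg c)
  have h3 := CStarAlgebra.norm_le_norm_of_nonneg_of_le (star_mul_self_nonneg a) h2
  rw [CStarRing.norm_star_mul_self] at h3
  nlinarith [norm_nonneg a]

open FreeStarAlg in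
theorem suSeminorms_bounded (q : ℝ) (x : FreeStarAlg) :
    ∃ M : ℝ, ∀ p ∈ suSeminorms q, p x ≤ M := by
  have hone : ∀ p : CStarSeminorm FreeStarAlg, p 1 ≤ 1 := fun p => by
    have h := p.star_mul_self 1
    rw [star_one, one_mul] at h
    nlinarith [p.nonneg 1]
  have hgen : ∀ p ∈ suSeminorms q, ∀ i, p (gen i) ≤ 1 := fun p hp i => by
    have h00 := (hp 0 0).1
    have hx : ((suMatrix q (gen 0) (gen 1)).conjTranspose * suMatrix q (gen 0) (gen 1) - 1) 0 0 =
        star (gen 0) * gen 0 + star (gen 1) * gen 1 - 1 := by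
      simp [suMatrix, Matrix.mul_apply]
    rw [hx, ← p.norm_of, norm_eq_zero] at h00
    have h : star (p.of (gen 0)) * p.of (gen 0) + star (p.of (gen 1)) * p.of (gen 1) = 1 := by
      rw [p.star_of, p.star_of, ← p.of_mul, ← p.of_mul, ← p.of_add,
        ← sub_add_cancel (star (gen 0) * gen 0 + star (gen 1) * gen 1) 1, p.of_add, h00, zero_add,
        p.of_one]
    have h1 : ‖(1 : p.Completion)‖ ≤ 1 := by
      rw [← p.of_one, p.norm_of]
      exact hone p
    rw [← p.norm_of]
    fin_cases i
    · exact norm_le_one_of_star_mul_add h1 _ _ h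
    · exact norm_le_one_of_star_mul_add h1 _ _ ((add_comm _ _).trans h)
  refine induction (P := fun x => ∃ M : ℝ, ∀ p ∈ suSeminorms q, p x ≤ M) x ?_ ?_ ?_
  · exact ⟨0, fun p _ => (map_zero p.toSeminorm).le⟩
  · rintro x y ⟨M, hM⟩ ⟨N, hN⟩
    exact ⟨M + N, fun p hp =>
      (map_add_le_add p.toSeminorm x y).trans (add_le_add (hM p hp) (hN p hp))⟩
  · intro c m
    refine ⟨‖c‖, fun p hp => ?_⟩
    have hw : p (term 1 m) ≤ 1 := by
      induction m using FreeMonoid.recOn with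
      | one => exact hone p
      | of_mul y ys ih =>
        have h1 : p (term 1 (FreeMonoid.of y)) ≤ 1 := by
          obtain ⟨i, b⟩ := y
          cases b
          · exact hgen p hp i
          · rw [← star_gen, p.map_star]; exact hgen p hp i
        have h2 : term 1 (FreeMonoid.of y * ys) = term 1 (FreeMonoid.of y) * term 1 ys := by
          rw [term_mul, one_mul]
        rw [h2]
        exact (p.mul_le _ _).trans (mul_le_one₀ h1 (p.nonneg _) ih)
    have h3 : term c m = c • term 1 m := by rw [smul_term, mul_one]
    rw [h3, map_smul_eq_mul p.toSeminorm]
    exact mul_le_of_le_one_right (norm_nonneg c) hw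

/-- The universal unital C*-algebra `SU_q(2)` generated by two elements `α, γ` for which the matrix
`[[α, -q γ*], [γ, α*]]` is unitary: the completion of the free *-algebra in the largest C*-seminorm
for which the relations hold. -/
def SUq (q : ℝ) : Type := (CStarSeminorm.sup (suSeminorms q) (suSeminorms_bounded q)).Completion

namespace SUq

instance (q : ℝ) : CStarAlgebra (SUq q) := inferInstanceAs
  (CStarAlgebra (CStarSeminorm.sup (suSeminorms q) (suSeminorms_bounded q)).Completion)

/-- The generator `α` of `SU_q(2)`. -/
def α (q : ℝ) : SUq q := CStarSeminorm.of _ (FreeStarAlg.gen 0)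

/-- The generator `γ` of `SU_q(2)`. -/
def γ (q : ℝ) : SUq q := CStarSeminorm.of _ (FreeStarAlg.gen 1)

end SUq

end SUq

end

noncomputable section

universe u v

/-! ### Star homomorphisms on completions -/

/-! Write U for the fundamental matrix of `SUq q`. The prescribed values of Δ on α and γ are the
first column of the matrix product (U ⊗ 1)(1 ⊗ U), so Δ must satisfy Δ(U i j) = ∑ U i k ⊗ U k j. As
q is real, the second column of this product has the form demanded by `suMatrix`
(`SUq.comulMatrix_eq`). A product of two unitary matrices is unitary, so the universal property
`SUq.exists_lift` produces Δ. Both sides of the coassociativity identity send U i j to ∑ U i k ⊗ U k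
l ⊗ U l j, and *-homomorphisms on `SUq q` are determined by the generators.

The analytic work lies in the maps Δ ⊗ id, id ⊗ Δ and the associator. The first two exist because
representations pull back (`exists_minTensor_map`). For the associator the two norms on the
algebraic triple tensor product must agree. The norm of (A ⊗ B) ⊗ C involves arbitrary
representations of the C*-algebra A ⊗ B, whereas only product representations π ⊗ ρ can be
regrouped. The gap is closed by `norm_tensorRep_le_of_separating`: in one tensor factor a separating
family of representations already gives the full norm. To see this, compress to a finite dimensional
subspace of the other Hilbert space. The element becomes a matrix over D, and the C*-algebra of
matrices over D has only one faithful C*-seminorm, its norm. Product representations separate the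
points of the minimal tensor product by the very definition of its norm.

For density, Δ(U) = (U ⊗ 1)(1 ⊗ U) can be solved for either factor, since U is unitary: Δ(U)(1 ⊗ U*)
= U ⊗ 1 and Δ(U*)(U ⊗ 1) = 1 ⊗ U*. So the entries of U, respectively of U*, embed into the two
spans. The elements with this property form a subalgebra, which is dense when q ≠ 0, for then γ* is
a multiple of an entry of U. -/

/-- A *-homomorphism into a C*-algebra which is dominated by a *-homomorphism with dense range
factors through the latter. -/
theorem StarAlgHom.exists_extension {P X Y : Type*} [Ring P] [StarRing P] [Algebra ℂ P]
    [CStarAlgebra X] [CStarAlgebra Y] (f : P →⋆ₐ[ℂ] X) (g : P →⋆ₐ[ℂ] Y) (hf : DenseRange f)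
    (h : ∀ p, ‖g p‖ ≤ ‖f p‖) : ∃ φ : X →⋆ₐ[ℂ] Y, ∀ p, φ (f p) = g p := by
  let fl : P →ₗ[ℂ] X := f.toAlgHom.toLinearMap
  let gl : P →ₗ[ℂ] Y := g.toAlgHom.toLinearMap
  have hd : DenseRange fl := hf
  let L : X →L[ℂ] Y := gl.extendOfNorm fl
  have hL : ∀ p, L (f p) = g p := fun p =>
    LinearMap.extendOfNorm_eq (f := gl) (e := fl) hd ⟨1, fun x => by rw [one_mul]; exact h x⟩ p
  have hLc : Continuous L := L.continuous
  refine ⟨{ toFun := L, map_one' := ?_, map_mul' := ?_, map_zero' := map_zero L,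
            map_add' := map_add L, commutes' := ?_, map_star' := ?_ }, hL⟩
  · rw [← map_one f, hL, map_one]
  · intro x y
    refine hf.induction_on₂ (p := fun x y => L (x * y) = L x * L y) ?_ ?_ x y
    · exact isClosed_eq (by fun_prop) (by fun_prop)
    · intro a b
      rw [← map_mul, hL, hL, hL, map_mul]
  · intro r
    change L (algebraMap ℂ X r) = _
    rw [Algebra.algebraMap_eq_smul_one, map_smul, ← map_one f, hL, map_one,
      Algebra.algebraMap_eq_smul_one]
  · intro x
    refine hf.induction_on (p := fun x => L (star x) = star (L x)) x ?_ ?_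
    · exact isClosed_eq (by fun_prop) (by fun_prop)
    · intro a
      rw [← map_star, hL, hL, map_star]

theorem StarAlgHom.continuous_cstarAlgebra {X Y : Type*} [CStarAlgebra X] [CStarAlgebra Y]
    (φ : X →⋆ₐ[ℂ] Y) : Continuous φ :=
  AddMonoidHomClass.continuous_of_bound φ 1 fun x => by
    rw [one_mul]; exact NonUnitalStarAlgHom.norm_apply_le φ x

/-- *-homomorphisms of C*-algebras which agree on the range of a map with dense range are equal. -/
theorem StarAlgHom.ext_of_denseRange {P X Y : Type*} [CStarAlgebra X] [CStarAlgebra Y]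
    {f : P → X} (hf : DenseRange f) {φ ψ : X →⋆ₐ[ℂ] Y} (h : ∀ p, φ (f p) = ψ (f p)) : φ = ψ :=
  DFunLike.coe_injective <| hf.equalizer
    φ.continuous_cstarAlgebra ψ.continuous_cstarAlgebra (funext h)

/-- Two *-homomorphisms with dense ranges that induce the same norm have isomorphic codomains. -/
theorem StarAlgHom.exists_starAlgEquiv {P X Y : Type*} [Ring P] [StarRing P] [Algebra ℂ P]
    [CStarAlgebra X] [CStarAlgebra Y] (f : P →⋆ₐ[ℂ] X) (g : P →⋆ₐ[ℂ] Y) (hf : DenseRange f)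
    (hg : DenseRange g) (h : ∀ p, ‖f p‖ = ‖g p‖) : ∃ φ : X ≃⋆ₐ[ℂ] Y, ∀ p, φ (f p) = g p := by
  obtain ⟨φ, hφ⟩ := StarAlgHom.exists_extension f g hf fun p => (h p).ge
  obtain ⟨ψ, hψ⟩ := StarAlgHom.exists_extension g f hg fun p => (h p).le
  refine ⟨StarAlgEquiv.ofStarAlgHom φ ψ ?_ ?_, hφ⟩
  · exact StarAlgHom.ext_of_denseRange hf fun p => by simp [hφ, hψ]
  · exact StarAlgHom.ext_of_denseRange hg fun p => by simp [hφ, hψ]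

namespace CStarSeminorm

section

variable {A : Type u} [Ring A] [StarRing A] [Algebra ℂ A]

theorem le_sup {S : Set (CStarSeminorm A)} (hS : ∀ x, ∃ M : ℝ, ∀ p ∈ S, p x ≤ M)
    {p : CStarSeminorm A} (hp : p ∈ S) (x : A) : p x ≤ sup S hS x := by
  obtain ⟨M, hM⟩ := hS x
  exact le_ciSup (f := fun p : S => p.1 x) ⟨M, by rintro _ ⟨p, rfl⟩; exact hM p.1 p.2⟩ ⟨p, hp⟩

theorem sup_le {S : Set (CStarSeminorm A)} (hS : ∀ x, ∃ M : ℝ, ∀ p ∈ S, p x ≤ M)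
    {x : A} {M : ℝ} (hM : 0 ≤ M) (h : ∀ p ∈ S, p x ≤ M) : sup S hS x ≤ M :=
  Real.iSup_le (fun p => h p.1 p.2) hM

/-- The C*-seminorm `x ↦ ‖φ x‖` of a *-homomorphism into a C*-algebra. -/
def ofStarAlgHom {X : Type*} [CStarAlgebra X] (φ : A →⋆ₐ[ℂ] X) : CStarSeminorm A where
  toFun x := ‖φ x‖
  map_zero' := by simp
  add_le' x y := by rw [map_add]; exact norm_add_le _ _
  neg' x := by rw [map_neg, norm_neg]
  smul' c x := by rw [map_smul, norm_smul]
  mul_le' x y := by rw [map_mul]; exact norm_mul_le _ _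
  star_mul_self' x := by
    rw [map_mul φ, StarHomClass.map_star φ, CStarRing.norm_star_mul_self]

theorem ofStarAlgHom_apply {X : Type*} [CStarAlgebra X] (φ : A →⋆ₐ[ℂ] X) (x : A) :
    ofStarAlgHom φ x = ‖φ x‖ := rfl

variable [StarModule ℂ A] (p : CStarSeminorm A)

/-- The canonical *-homomorphism from `A` to its completion with respect to `p`. -/
def ofHom : A →⋆ₐ[ℂ] p.Completion where
  toFun := p.of
  map_one' := p.of_one
  map_mul' := p.of_mul
  map_zero' := by simpa using p.of_smul 0 0
  map_add' := p.of_add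
  commutes' r := by
    rw [Algebra.algebraMap_eq_smul_one, of_smul, of_one, Algebra.algebraMap_eq_smul_one]
  map_star' x := (p.star_of x).symm

@[simp]
theorem ofHom_apply (x : A) : p.ofHom x = p.of x := rfl

theorem denseRange_ofHom : DenseRange p.ofHom :=
  UniformSpace.Completion.denseRange_coe (α := p.Carrier)

end

section CStarAlgebra

variable {D : Type u} [CStarAlgebra D] (p : CStarSeminorm D)

/-- *-homomorphisms between C*-algebras are contractive, and the map to the completion for `p` is
one. No continuity of `p` is assumed. -/
theorem le_norm (x : D) : p x ≤ ‖x‖ := by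
  rw [← p.norm_of]
  exact NonUnitalStarAlgHom.norm_apply_le p.ofHom x

/-- A faithful C*-seminorm on a C*-algebra is its norm. -/
theorem eq_norm (hp : ∀ x, p x = 0 → x = 0) (x : D) : p x = ‖x‖ := by
  rw [← p.norm_of]
  -- An injective *-homomorphism of C*-algebras is isometric.
  refine NonUnitalStarAlgHom.norm_map p.ofHom ?_ x
  refine (injective_iff_map_eq_zero p.ofHom).2 fun y hy => hp y ?_
  rw [← p.norm_of, ← ofHom_apply, hy, norm_zero]

end CStarAlgebra

end CStarSeminorm

/-! ### *-homomorphisms on algebraic tensor products -/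

/-- The tensor product of two *-homomorphisms. -/
def StarAlgHom.tensorMap {A B C D : Type*} [Ring A] [StarRing A] [Algebra ℂ A] [StarModule ℂ A]
    [Ring B] [StarRing B] [Algebra ℂ B] [StarModule ℂ B]
    [Ring C] [StarRing C] [Algebra ℂ C] [StarModule ℂ C]
    [Ring D] [StarRing D] [Algebra ℂ D] [StarModule ℂ D]
    (φ : A →⋆ₐ[ℂ] C) (ψ : B →⋆ₐ[ℂ] D) : A ⊗[ℂ] B →⋆ₐ[ℂ] C ⊗[ℂ] D where
  __ := Algebra.TensorProduct.map φ.toAlgHom ψ.toAlgHom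
  map_star' x := by
    induction x using TensorProduct.induction_on with
    | zero => simp
    | add x y hx hy => simp_all
    | tmul a b => simp [map_star]

@[simp]
theorem StarAlgHom.tensorMap_tmul {A B C D : Type*}
    [Ring A] [StarRing A] [Algebra ℂ A] [StarModule ℂ A]
    [Ring B] [StarRing B] [Algebra ℂ B] [StarModule ℂ B]
    [Ring C] [StarRing C] [Algebra ℂ C] [StarModule ℂ C]
    [Ring D] [StarRing D] [Algebra ℂ D] [StarModule ℂ D]
    (φ : A →⋆ₐ[ℂ] C) (ψ : B →⋆ₐ[ℂ] D) (a : A) (b : B) :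
    StarAlgHom.tensorMap φ ψ (a ⊗ₜ b) = φ a ⊗ₜ ψ b := rfl

/-- Associativity of the algebraic tensor product of *-algebras. -/
def StarAlgHom.tensorAssoc (A B C : Type*) [Ring A] [StarRing A] [Algebra ℂ A] [StarModule ℂ A]
    [Ring B] [StarRing B] [Algebra ℂ B] [StarModule ℂ B]
    [Ring C] [StarRing C] [Algebra ℂ C] [StarModule ℂ C] :
    (A ⊗[ℂ] B) ⊗[ℂ] C →⋆ₐ[ℂ] A ⊗[ℂ] (B ⊗[ℂ] C) where
  __ := (Algebra.TensorProduct.assoc ℂ ℂ ℂ A B C).toAlgHom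
  map_star' x := by
    induction x using TensorProduct.induction_on with
    | zero => simp
    | add x y hx hy => simp_all
    | tmul x c =>
      induction x using TensorProduct.induction_on with
      | zero => simp
      | add x y hx hy => simp_all [TensorProduct.add_tmul]
      | tmul a b => simp

@[simp]
theorem StarAlgHom.tensorAssoc_tmul {A B C : Type*}
    [Ring A] [StarRing A] [Algebra ℂ A] [StarModule ℂ A]
    [Ring B] [StarRing B] [Algebra ℂ B] [StarModule ℂ B]
    [Ring C] [StarRing C] [Algebra ℂ C] [StarModule ℂ C] (a : A) (b : B) (c : C) :
    StarAlgHom.tensorAssoc A B C (a ⊗ₜ b ⊗ₜ c) = a ⊗ₜ (b ⊗ₜ c) := rfl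

/-! ### The minimal tensor product -/

section MinTensor

/-- A representation of a C*-algebra on a Hilbert space. -/
structure HilbertRep (A : Type u) [CStarAlgebra A] where
  /-- The Hilbert space. -/
  space : Type u
  [normed : NormedAddCommGroup space]
  [inner : InnerProductSpace ℂ space]
  [complete : CompleteSpace space]
  /-- The representation. -/
  rep : A →⋆ₐ[ℂ] (space →L[ℂ] space)

attribute [instance] HilbertRep.normed HilbertRep.inner HilbertRep.complete

section

variable {A : Type u} {B : Type v} [CStarAlgebra A] [CStarAlgebra B]

theorem norm_tensorRep_le_minSeminorm
    {H : Type u} [NormedAddCommGroup H] [InnerProductSpace ℂ H] [CompleteSpace H]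
    {K : Type v} [NormedAddCommGroup K] [InnerProductSpace ℂ K] [CompleteSpace K]
    (π : A →⋆ₐ[ℂ] (H →L[ℂ] H)) (ρ : B →⋆ₐ[ℂ] (K →L[ℂ] K)) (x : A ⊗[ℂ] B) :
    ‖tensorRep π ρ x‖ ≤ minSeminorm A B x := by
  rw [← tensorRepSeminorm_apply]
  exact CStarSeminorm.le_sup (S := spatialSeminorms A B) _ (p := tensorRepSeminorm π ρ)
    ⟨H, _, _, inferInstance, K, _, _, inferInstance, π, ρ, rfl⟩ x

theorem minSeminorm_le {x : A ⊗[ℂ] B} {M : ℝ} (hM : 0 ≤ M)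
    (h : ∀ (π : HilbertRep A) (ρ : HilbertRep B), ‖tensorRep π.rep ρ.rep x‖ ≤ M) :
    minSeminorm A B x ≤ M := by
  refine CStarSeminorm.sup_le _ hM ?_
  rintro p ⟨H, _, _, _, K, _, _, _, π, ρ, rfl⟩
  exact h ⟨H, π⟩ ⟨K, ρ⟩

variable (A B) in
/-- The canonical *-homomorphism from the algebraic to the minimal tensor product. -/
def minOf : A ⊗[ℂ] B →⋆ₐ[ℂ] MinTensor A B := (minSeminorm A B).ofHom

theorem minOf_tmul (a : A) (b : B) : minOf A B (a ⊗ₜ b) = minTmul a b := rfl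

theorem norm_minOf (x : A ⊗[ℂ] B) : ‖minOf A B x‖ = minSeminorm A B x :=
  (minSeminorm A B).norm_of x

theorem denseRange_minOf : DenseRange (minOf A B) := (minSeminorm A B).denseRange_ofHom

theorem norm_minTmul_le (a : A) (b : B) : ‖minTmul a b‖ ≤ ‖a‖ * ‖b‖ := by
  rw [← minOf_tmul, norm_minOf]
  refine minSeminorm_le (by positivity) fun π ρ => ?_
  rw [tensorRep_tmul]
  refine (TensorProduct.norm_mapL_le _ _).trans ?_
  gcongr
  · exact NonUnitalStarAlgHom.norm_apply_le π.rep a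
  · exact NonUnitalStarAlgHom.norm_apply_le ρ.rep b

/-- The bilinear map `(a, b) ↦ a ⊗ b` into the minimal tensor product. -/
def minTmulL : A →L[ℂ] B →L[ℂ] MinTensor A B :=
  LinearMap.mkContinuous₂ ((TensorProduct.mk ℂ A B).compr₂ (minOf A B).toAlgHom.toLinearMap) 1
    fun a b => by rw [one_mul]; exact norm_minTmul_le a b

theorem continuous_minTmul_left (b : B) : Continuous fun a : A => minTmul a b :=
  ((minTmulL (A := A) (B := B)).flip b).continuous

theorem continuous_minTmul_right (a : A) : Continuous fun b : B => minTmul a b :=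
  (minTmulL a).continuous

theorem minTmul_add (a : A) (b b' : B) : minTmul a (b + b') = minTmul a b + minTmul a b' :=
  map_add (minTmulL a) b b'

theorem add_minTmul (a a' : A) (b : B) : minTmul (a + a') b = minTmul a b + minTmul a' b :=
  map_add ((minTmulL (A := A) (B := B)).flip b) a a'

theorem minTmul_sub (a : A) (b b' : B) : minTmul a (b - b') = minTmul a b - minTmul a b' :=
  map_sub (minTmulL a) b b'

theorem sub_minTmul (a a' : A) (b : B) : minTmul (a - a') b = minTmul a b - minTmul a' b :=
  map_sub ((minTmulL (A := A) (B := B)).flip b) a a'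

theorem minTmul_neg (a : A) (b : B) : minTmul a (-b) = -minTmul a b :=
  map_neg (minTmulL a) b

theorem neg_minTmul (a : A) (b : B) : minTmul (-a) b = -minTmul a b :=
  map_neg ((minTmulL (A := A) (B := B)).flip b) a

theorem minTmul_smul (c : ℂ) (a : A) (b : B) : minTmul a (c • b) = c • minTmul a b :=
  map_smul (minTmulL a) c b

theorem smul_minTmul (c : ℂ) (a : A) (b : B) : minTmul (c • a) b = c • minTmul a b :=
  map_smul ((minTmulL (A := A) (B := B)).flip b) c a

theorem minTmul_mul_minTmul (a a' : A) (b b' : B) :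
    minTmul a b * minTmul a' b' = minTmul (a * a') (b * b') := by
  rw [← minOf_tmul, ← minOf_tmul, ← minOf_tmul, ← map_mul, Algebra.TensorProduct.tmul_mul_tmul]

theorem star_minTmul (a : A) (b : B) : star (minTmul a b) = minTmul (star a) (star b) := by
  rw [← minOf_tmul, ← minOf_tmul, ← map_star, TensorProduct.star_tmul]

theorem minTmul_one_one : minTmul (1 : A) (1 : B) = 1 := map_one (minOf A B)

variable (A B) in
/-- The *-homomorphism `a ↦ a ⊗ 1`. -/
def minInclLeft : A →⋆ₐ[ℂ] MinTensor A B where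
  toFun a := minTmul a 1
  map_one' := minTmul_one_one
  map_mul' a a' := by rw [minTmul_mul_minTmul, one_mul]
  map_zero' := map_zero ((minTmulL (A := A) (B := B)).flip 1)
  map_add' a a' := add_minTmul a a' 1
  commutes' r := by
    rw [Algebra.algebraMap_eq_smul_one, smul_minTmul, minTmul_one_one,
      Algebra.algebraMap_eq_smul_one]
  map_star' a := by rw [star_minTmul, star_one]

variable (A B) in
/-- The *-homomorphism `b ↦ 1 ⊗ b`. -/
def minInclRight : B →⋆ₐ[ℂ] MinTensor A B where
  toFun b := minTmul 1 b
  map_one' := minTmul_one_one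
  map_mul' b b' := by rw [minTmul_mul_minTmul, one_mul]
  map_zero' := map_zero (minTmulL (A := A) (B := B) 1)
  map_add' b b' := minTmul_add 1 b b'
  commutes' r := by
    rw [Algebra.algebraMap_eq_smul_one, minTmul_smul, minTmul_one_one,
      Algebra.algebraMap_eq_smul_one]
  map_star' b := by rw [star_minTmul, star_one]

theorem minInclLeft_apply (a : A) : minInclLeft A B a = minTmul a 1 := rfl

theorem minInclRight_apply (b : B) : minInclRight A B b = minTmul 1 b := rfl

theorem minInclLeft_mul_minInclRight (a : A) (b : B) :
    minInclLeft A B a * minInclRight A B b = minTmul a b := by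
  rw [minInclLeft_apply, minInclRight_apply, minTmul_mul_minTmul, mul_one, one_mul]

theorem minInclRight_mul_minInclLeft (a : A) (b : B) :
    minInclRight A B b * minInclLeft A B a = minTmul a b := by
  rw [minInclLeft_apply, minInclRight_apply, minTmul_mul_minTmul, mul_one, one_mul]

/-- A subspace of the minimal tensor product is dense if its closure contains the elementary
tensors. -/
theorem dense_of_minTmul_mem (S : Submodule ℂ (MinTensor A B))
    (h : ∀ a b, minTmul a b ∈ closure (S : Set (MinTensor A B))) :
    Dense (S : Set (MinTensor A B)) := by
  have h1 : Set.range (minOf A B) ⊆ closure (S : Set (MinTensor A B)) := by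
    rintro _ ⟨x, rfl⟩
    rw [← Submodule.topologicalClosure_coe]
    induction x using TensorProduct.induction_on with
    | zero => rw [map_zero]; exact zero_mem _
    | add x y hx hy => rw [map_add]; exact add_mem hx hy
    | tmul a b => rw [Submodule.topologicalClosure_coe]; exact h a b
  exact dense_closure.1 (denseRange_minOf.mono h1)

end

/-- The minimal tensor product is functorial. -/
theorem exists_minTensor_map {A C : Type u} {B D : Type v} [CStarAlgebra A] [CStarAlgebra B]
    [CStarAlgebra C] [CStarAlgebra D] (φ : A →⋆ₐ[ℂ] C) (ψ : B →⋆ₐ[ℂ] D) :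
    ∃ θ : MinTensor A B →⋆ₐ[ℂ] MinTensor C D, ∀ a b, θ (minTmul a b) = minTmul (φ a) (ψ b) := by
  obtain ⟨θ, hθ⟩ := StarAlgHom.exists_extension (minOf A B)
    ((minOf C D).comp (StarAlgHom.tensorMap φ ψ)) denseRange_minOf fun x => by
      rw [StarAlgHom.comp_apply, norm_minOf, norm_minOf]
      -- Representations of `C` and `D` pull back along `φ` and `ψ` to representations of `A` and
      -- `B`, which take part in the supremum defining the norm of A ⊗ B.
      refine minSeminorm_le (CStarSeminorm.nonneg _ _) fun π ρ => ?_
      refine le_of_eq_of_le ?_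
        (norm_tensorRep_le_minSeminorm (π.rep.comp φ) (ρ.rep.comp ψ) x)
      congr 1
      induction x using TensorProduct.induction_on with
      | zero => simp
      | add x y hx hy => rw [map_add, map_add, map_add, hx, hy]
      | tmul a b => rfl
  exact ⟨θ, fun a b => hθ (a ⊗ₜ b)⟩

end MinTensor

/-! ### Independence of the spatial norm from the representation -/

section Compression

open InnerProductSpace

variable {D : Type u} [CStarAlgebra D] {H : Type u} [NormedAddCommGroup H] [InnerProductSpace ℂ H] [CompleteSpace H]
  {K : Type v} [NormedAddCommGroup K] [InnerProductSpace ℂ K]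
  (π : D →⋆ₐ[ℂ] (H →L[ℂ] H)) {n : ℕ} (e : Fin n → K)

/-- The operator `∑ π (m i j) ⊗ |e i⟩⟨e j|` on `H ⊗ K` of a matrix `m` over `D`, for a family of
vectors `e` in `K`. -/
def matrixRep : CStarMatrix (Fin n) (Fin n) D →ₗ[ℂ] (H ⊗[ℂ] K →L[ℂ] H ⊗[ℂ] K) where
  toFun m := ∑ i, ∑ j, TensorProduct.mapL (π (m i j)) (rankOne ℂ (e i) (e j))
  map_add' m m' := by
    simp only [CStarMatrix.add_apply, map_add, TensorProduct.mapL_add_left,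
      Finset.sum_add_distrib]
  map_smul' c m := by
    simp only [CStarMatrix.smul_apply, map_smul, TensorProduct.mapL_smul_left, Finset.smul_sum,
      RingHom.id_apply]

theorem matrixRep_apply (m : CStarMatrix (Fin n) (Fin n) D) :
    matrixRep π e m = ∑ i, ∑ j, TensorProduct.mapL (π (m i j)) (rankOne ℂ (e i) (e j)) := rfl

theorem matrixRep_apply_tmul (m : CStarMatrix (Fin n) (Fin n) D) (h : H) (k : K) :
    matrixRep π e m (h ⊗ₜ k) = ∑ i, ∑ j, (inner ℂ (e j) k) • (π (m i j) h ⊗ₜ[ℂ] e i) := by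
  simp [matrixRep_apply]

variable {e}

/-- For orthonormal `e` the operators |e i⟩⟨e j| multiply like matrix units. -/
theorem matrixRep_mul (he : Orthonormal ℂ e) (m m' : CStarMatrix (Fin n) (Fin n) D) :
    matrixRep π e (m * m') = matrixRep π e m * matrixRep π e m' := by
  ext x
  induction x using TensorProduct.induction_on with
  | zero => simp
  | add x y hx hy => rw [map_add, map_add, hx, hy]
  | tmul h k =>
    rw [mul_apply_eq_comp, matrixRep_apply_tmul, matrixRep_apply_tmul]
    simp only [map_sum, map_smul, matrixRep_apply_tmul, orthonormal_iff_ite.1 he,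
      CStarMatrix.mul_apply, map_mul, ite_smul, one_smul, zero_smul, Finset.sum_ite_eq',
      Finset.mem_univ, if_true, sum_apply, mul_apply_eq_comp,
      TensorProduct.sum_tmul, Finset.smul_sum]
    refine Finset.sum_comm.trans (Eq.trans ?_ Finset.sum_comm)
    exact Finset.sum_congr rfl fun j _ => Finset.sum_comm

theorem inner_matrixRep (m : CStarMatrix (Fin n) (Fin n) D) (v w : H ⊗[ℂ] K) :
    inner ℂ (matrixRep π e (star m) v) w = inner ℂ v (matrixRep π e m w) := by
  induction v using TensorProduct.induction_on with
  | zero => simp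
  | add v v' hv hv' => rw [map_add, inner_add_left, inner_add_left, hv, hv']
  | tmul h k =>
    induction w using TensorProduct.induction_on with
    | zero => simp
    | add w w' hw hw' => rw [map_add, inner_add_right, inner_add_right, hw, hw']
    | tmul h' k' =>
      rw [matrixRep_apply_tmul, matrixRep_apply_tmul]
      simp only [sum_inner, inner_sum, TensorProduct.smul_tmul', inner_smul_left, inner_smul_right,
        TensorProduct.inner_tmul, CStarMatrix.star_apply, map_star,
        ContinuousLinearMap.star_eq_adjoint, ContinuousLinearMap.adjoint_inner_left,
        inner_conj_symm]
      rw [Finset.sum_comm]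
      refine Finset.sum_congr rfl fun i _ => Finset.sum_congr rfl fun j _ => ?_
      ring

/-- Pairing the image of x ⊗ e j with π (m i j) x ⊗ e i isolates ‖π (m i j) x‖². Hence a separating
family of representations of `D` is jointly faithful on matrices. -/
theorem matrixRep_entry (he : Orthonormal ℂ e) (m : CStarMatrix (Fin n) (Fin n) D)
    (h : matrixRep π e m = 0) (i j : Fin n) : π (m i j) = 0 := by
  ext x
  have h1 : inner ℂ (π (m i j) x ⊗ₜ[ℂ] e i) (matrixRep π e m (x ⊗ₜ e j)) = 0 := by
    rw [h]; simp
  rw [matrixRep_apply_tmul] at h1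
  simpa [inner_sum, inner_smul_right, orthonormal_iff_ite.1 he] using h1

/-- The C*-seminorm `m ↦ ‖∑ π (m i j) ⊗ |e i⟩⟨e j|‖` on matrices, for an orthonormal family `e`. -/
def matrixRepSeminorm (he : Orthonormal ℂ e) : CStarSeminorm (CStarMatrix (Fin n) (Fin n) D) :=
  repSeminorm (matrixRep π e) (matrixRep_mul π he) (inner_matrixRep π)

theorem matrixRepSeminorm_apply (he : Orthonormal ℂ e) (m : CStarMatrix (Fin n) (Fin n) D) :
    matrixRepSeminorm π he m = ‖matrixRep π e m‖ := rfl

/-- Up to the norm, matrices over `D` are determined by a separating family of representations. -/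
theorem norm_matrixRep_le {ι : Type*} {G : ι → Type u} [∀ i, NormedAddCommGroup (G i)]
    [∀ i, InnerProductSpace ℂ (G i)] [∀ i, CompleteSpace (G i)]
    (s : ∀ i, D →⋆ₐ[ℂ] (G i →L[ℂ] G i)) (hs : ∀ d, (∀ i, s i d = 0) → d = 0)
    (he : Orthonormal ℂ e) (m : CStarMatrix (Fin n) (Fin n) D) {M : ℝ} (hM : 0 ≤ M)
    (h : ∀ i, ‖matrixRep (s i) e m‖ ≤ M) : ‖matrixRep π e m‖ ≤ M := by
  -- The spectral order on `D` is what the C*-algebra structure on matrices over `D` is built on.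
  -- With it, every C*-seminorm on matrices is at most the norm, while the supremum over the
  -- separating family is faithful and so equals the norm.
  let _ := CStarAlgebra.spectralOrder D
  have _ := CStarAlgebra.spectralOrderedRing D
  let S : Set (CStarSeminorm (CStarMatrix (Fin n) (Fin n) D)) :=
    Set.range fun i => matrixRepSeminorm (s i) he
  have hS : ∀ x, ∃ M : ℝ, ∀ p ∈ S, p x ≤ M := fun x => ⟨‖x‖, fun p _ => p.le_norm x⟩
  have hf : ∀ x, CStarSeminorm.sup S hS x = 0 → x = 0 := fun x hx => by
    refine CStarMatrix.ext fun k l => hs _ fun i => ?_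
    refine matrixRep_entry (s i) he x ?_ k l
    refine (norm_le_zero_iff (a := matrixRep (s i) e x)).1 ?_
    rw [← matrixRepSeminorm_apply _ he, ← hx]
    exact CStarSeminorm.le_sup hS ⟨i, rfl⟩ x
  calc ‖matrixRep π e m‖ = matrixRepSeminorm π he m := rfl
    _ ≤ ‖m‖ := CStarSeminorm.le_norm _ m
    _ = CStarSeminorm.sup S hS m := (CStarSeminorm.eq_norm _ hf m).symm
    _ ≤ M := by
      refine CStarSeminorm.sup_le hS hM ?_
      rintro _ ⟨i, rfl⟩
      exact h i

end Compression

section Spatial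

open InnerProductSpace

variable {D : Type u} [CStarAlgebra D] {C : Type v} [CStarAlgebra C]
  {K : Type v} [NormedAddCommGroup K] [InnerProductSpace ℂ K] [CompleteSpace K]

/-- The compression of an element of `D ⊗ B(K)` to a finite dimensional subspace of `K` is a matrix
over `D`, which does not depend on a representation of `D`. -/
theorem exists_matrixRep_eq_compress (ρ : C →⋆ₐ[ℂ] (K →L[ℂ] K)) {n : ℕ} (e : Fin n → K)
    (x : D ⊗[ℂ] C) : ∃ m : CStarMatrix (Fin n) (Fin n) D,
      ∀ (H : Type u) [NormedAddCommGroup H] [InnerProductSpace ℂ H] [CompleteSpace H]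
        (π : D →⋆ₐ[ℂ] (H →L[ℂ] H)), matrixRep π e m =
          TensorProduct.mapL (.id ℂ H) (∑ i, rankOne ℂ (e i) (e i)) * tensorRep π ρ x *
            TensorProduct.mapL (.id ℂ H) (∑ i, rankOne ℂ (e i) (e i)) := by
  induction x using TensorProduct.induction_on with
  | zero => exact ⟨0, fun H _ _ _ π => by simp⟩
  | add x y hx hy =>
    obtain ⟨m, hm⟩ := hx
    obtain ⟨m', hm'⟩ := hy
    exact ⟨m + m', fun H _ _ _ π => by rw [map_add, map_add, hm, hm', mul_add, add_mul]⟩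
  | tmul d c =>
    -- Compressing `ρ c` leaves ∑ ⟨e i, ρ c (e j)⟩ |e i⟩⟨e j|; moving the scalars to the left leg
    -- gives the entries, in which `π` does not occur.
    refine ⟨CStarMatrix.ofMatrix (Matrix.of fun i j => inner ℂ (e i) (ρ c (e j)) • d),
      fun H _ _ _ π => ?_⟩
    ext x
    induction x using TensorProduct.induction_on with
    | zero => simp
    | add x y hx hy => rw [map_add, map_add, hx, hy]
    | tmul h k =>
      rw [matrixRep_apply_tmul, tensorRep_tmul]
      simp [TensorProduct.tmul_sum, map_sum, smul_smul, TensorProduct.smul_tmul',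
        CStarMatrix.ofMatrix_apply]
      rw [Finset.sum_comm]
      refine Finset.sum_congr rfl fun i _ => Finset.sum_congr rfl fun j _ => ?_
      rw [mul_comm]

/-- The spatial norm is determined by any separating family of representations of the first
factor. -/
theorem norm_tensorRep_le_of_separating {ι : Type*} {G : ι → Type u}
    [∀ i, NormedAddCommGroup (G i)] [∀ i, InnerProductSpace ℂ (G i)] [∀ i, CompleteSpace (G i)]
    (s : ∀ i, D →⋆ₐ[ℂ] (G i →L[ℂ] G i)) (hs : ∀ d, (∀ i, s i d = 0) → d = 0)
    {H : Type u} [NormedAddCommGroup H] [InnerProductSpace ℂ H] [CompleteSpace H]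
    (π : D →⋆ₐ[ℂ] (H →L[ℂ] H)) (ρ : C →⋆ₐ[ℂ] (K →L[ℂ] K)) (x : D ⊗[ℂ] C) {M : ℝ} (hM : 0 ≤ M)
    (h : ∀ i, ‖tensorRep (s i) ρ x‖ ≤ M) : ‖tensorRep π ρ x‖ ≤ M := by
  refine ContinuousLinearMap.opNorm_le_bound _ hM fun v => ?_
  -- The vector and its image are finite sums of elementary tensors, so both lie in H ⊗ K' with `K'`
  -- finite dimensional. The projection onto H ⊗ K' fixes both, so at `v` the operator may be
  -- replaced by its compression.
  obtain ⟨K', hfin, hK'⟩ := TensorProduct.exists_finite_submodule_right_of_setFinite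
    {v, tensorRep π ρ x v} (Set.toFinite _)
  let b := stdOrthonormalBasis ℂ K'
  let e : Fin (Module.finrank ℂ K') → K := fun i => b i
  have he : Orthonormal ℂ e := b.orthonormal.comp_linearIsometry K'.subtypeₗᵢ
  have hP : ∑ i, rankOne ℂ (e i) (e i) = K'.starProjection :=
    (b.starProjection_eq_sum_rankOne).symm
  have hfix : ∀ w ∈ LinearMap.range (K'.subtype.lTensor H),
      TensorProduct.mapL (.id ℂ H) K'.starProjection w = w := by
    rintro _ ⟨w, rfl⟩
    induction w using TensorProduct.induction_on with
    | zero => simp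
    | add x y hx hy => rw [map_add, map_add, hx, hy]
    | tmul h k => simp
  obtain ⟨m, hm⟩ := exists_matrixRep_eq_compress ρ e x
  have hle : ∀ (F : Type u) [NormedAddCommGroup F] [InnerProductSpace ℂ F],
      ‖TensorProduct.mapL (.id ℂ F) K'.starProjection‖ ≤ 1 := fun F _ _ =>
    (TensorProduct.norm_mapL_le _ _).trans
      (mul_le_one₀ ContinuousLinearMap.norm_id_le (norm_nonneg _) K'.starProjection_norm_le)
  have hb : ‖matrixRep π e m‖ ≤ M := by
    refine norm_matrixRep_le π s hs he m hM fun i => ?_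
    rw [hm, hP]
    calc ‖TensorProduct.mapL (.id ℂ (G i)) K'.starProjection * tensorRep (s i) ρ x *
            TensorProduct.mapL (.id ℂ (G i)) K'.starProjection‖
        ≤ ‖TensorProduct.mapL (.id ℂ (G i)) K'.starProjection‖ * ‖tensorRep (s i) ρ x‖ *
          ‖TensorProduct.mapL (.id ℂ (G i)) K'.starProjection‖ :=
        (ContinuousLinearMap.opNorm_comp_le _ _).trans (mul_le_mul_of_nonneg_right
          (ContinuousLinearMap.opNorm_comp_le _ _) (norm_nonneg _))
      _ ≤ 1 * ‖tensorRep (s i) ρ x‖ * 1 := by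
        gcongr
        · exact hle _
        · exact hle _
      _ ≤ M := by rw [one_mul, mul_one]; exact h i
  have hv : tensorRep π ρ x v = matrixRep π e m v := by
    rw [hm, hP, mul_apply_eq_comp, mul_apply_eq_comp,
      hfix v (hK' (by simp)), hfix _ (hK' (by simp))]
  rw [hv]
  exact (matrixRep π e m).le_of_opNorm_le hb v

end Spatial

/-! ### Representations of the minimal tensor product -/

section MinTensorRep

open UniformSpace

variable {A : Type u} {B : Type v} [CStarAlgebra A] [CStarAlgebra B]
  {H : Type u} [NormedAddCommGroup H] [InnerProductSpace ℂ H] [CompleteSpace H]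
  {K : Type v} [NormedAddCommGroup K] [InnerProductSpace ℂ K] [CompleteSpace K]
  (π : A →⋆ₐ[ℂ] (H →L[ℂ] H)) (ρ : B →⋆ₐ[ℂ] (K →L[ℂ] K))

theorem ContinuousLinearMap.norm_completion {E : Type*} [NormedAddCommGroup E] [NormedSpace ℂ E]
    (T : E →L[ℂ] E) : ‖T.completion‖ = ‖T‖ := by
  refine le_antisymm ?_ ?_
  · refine ContinuousLinearMap.opNorm_le_bound _ (norm_nonneg _) fun v => ?_
    refine Completion.induction_on v (isClosed_le (by fun_prop) (by fun_prop)) fun a => ?_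
    rw [ContinuousLinearMap.completion_apply_coe, Completion.norm_coe, Completion.norm_coe]
    exact T.le_opNorm a
  · refine ContinuousLinearMap.opNorm_le_bound _ (norm_nonneg _) fun v => ?_
    rw [← Completion.norm_coe, ← Completion.norm_coe (v : E),
      ← ContinuousLinearMap.completion_apply_coe]
    exact ContinuousLinearMap.le_opNorm _ _

theorem ContinuousLinearMap.ext_completion {E F : Type*} [NormedAddCommGroup E] [NormedSpace ℂ E]
    [NormedAddCommGroup F] [NormedSpace ℂ F] {S T : Completion E →L[ℂ] F}
    (h : ∀ a : E, S a = T a) : S = T := by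
  ext v
  exact Completion.induction_on v (isClosed_eq (by fun_prop) (by fun_prop)) h

/-- The representation `π ⊗ ρ` of the algebraic tensor product on the Hilbert space tensor
product. -/
def tensorHilbertRep :
    A ⊗[ℂ] B →⋆ₐ[ℂ] (Completion (H ⊗[ℂ] K) →L[ℂ] Completion (H ⊗[ℂ] K)) where
  toFun x := (tensorRep π ρ x).completion
  map_one' := by
    refine ContinuousLinearMap.ext_completion fun a => ?_
    rw [ContinuousLinearMap.completion_apply_coe, Algebra.TensorProduct.one_def, tensorRep_tmul,
      map_one, map_one]
    congr 1
    exact DFunLike.congr_fun (TensorProduct.mapL_id_id (𝕜 := ℂ) (E := H) (G := K)) a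
  map_mul' x y := by
    refine ContinuousLinearMap.ext_completion fun a => ?_
    rw [mul_apply_eq_comp]
    simp only [ContinuousLinearMap.completion_apply_coe]
    rw [tensorRep_mul, mul_apply_eq_comp]
  map_zero' := by
    refine ContinuousLinearMap.ext_completion fun a => ?_
    rw [ContinuousLinearMap.completion_apply_coe, map_zero]
    simp
  map_add' x y := by
    refine ContinuousLinearMap.ext_completion fun a => ?_
    rw [add_apply]
    simp only [ContinuousLinearMap.completion_apply_coe]
    rw [map_add, add_apply, Completion.coe_add]
  commutes' r := by
    refine ContinuousLinearMap.ext_completion fun a => ?_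
    rw [ContinuousLinearMap.completion_apply_coe, Algebra.algebraMap_eq_smul_one,
      Algebra.algebraMap_eq_smul_one, map_smul, Algebra.TensorProduct.one_def, tensorRep_tmul,
      map_one, map_one, smul_apply, smul_apply, Completion.coe_smul]
    congr 2
    exact DFunLike.congr_fun (TensorProduct.mapL_id_id (𝕜 := ℂ) (E := H) (G := K)) a
  map_star' x := by
    rw [ContinuousLinearMap.star_eq_adjoint, ContinuousLinearMap.eq_adjoint_iff]
    intro v w
    refine Completion.induction_on₂ v w (isClosed_eq ?_ ?_) fun a b => ?_
    · exact Continuous.inner (by fun_prop) (by fun_prop)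
    · exact Continuous.inner (by fun_prop) (by fun_prop)
    · rw [ContinuousLinearMap.completion_apply_coe, ContinuousLinearMap.completion_apply_coe,
        Completion.inner_coe, Completion.inner_coe, inner_tensorRep]

theorem tensorHilbertRep_apply_coe (x : A ⊗[ℂ] B) (v : H ⊗[ℂ] K) :
    tensorHilbertRep π ρ x v = (tensorRep π ρ x v : H ⊗[ℂ] K) :=
  ContinuousLinearMap.completion_apply_coe _ _

theorem norm_tensorHilbertRep (x : A ⊗[ℂ] B) : ‖tensorHilbertRep π ρ x‖ = ‖tensorRep π ρ x‖ :=
  ContinuousLinearMap.norm_completion _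

/-- The norm of π ⊗ ρ is one of those whose supremum is the minimal norm, so the representation
extends continuously. -/
theorem exists_minTensorRep :
    ∃ θ : MinTensor A B →⋆ₐ[ℂ] (Completion (H ⊗[ℂ] K) →L[ℂ] Completion (H ⊗[ℂ] K)),
      ∀ x, θ (minOf A B x) = tensorHilbertRep π ρ x :=
  StarAlgHom.exists_extension (Y := Completion (H ⊗[ℂ] K) →L[ℂ] Completion (H ⊗[ℂ] K))
    (minOf A B) (tensorHilbertRep π ρ) denseRange_minOf fun x => by
    rw [norm_tensorHilbertRep, norm_minOf]
    exact norm_tensorRep_le_minSeminorm π ρ x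

/-- The representation `π ⊗ ρ` of the minimal tensor product on the Hilbert space tensor
product. -/
def minTensorRep :
    MinTensor A B →⋆ₐ[ℂ] (Completion (H ⊗[ℂ] K) →L[ℂ] Completion (H ⊗[ℂ] K)) :=
  (exists_minTensorRep π ρ).choose

theorem minTensorRep_minOf (x : A ⊗[ℂ] B) :
    minTensorRep π ρ (minOf A B x) = tensorHilbertRep π ρ x :=
  (exists_minTensorRep π ρ).choose_spec x

/-- Product representations separate the points of the minimal tensor product. -/
theorem eq_zero_of_minTensorRep (d : MinTensor A B)
    (h : ∀ i : HilbertRep A × HilbertRep B, minTensorRep i.1.rep i.2.rep d = 0) : d = 0 := by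
  refine norm_le_zero_iff.1 (le_of_forall_pos_le_add fun ε hε => ?_)
  -- A representation killing `d` sees the approximant only through its difference from `d`. So
  -- every product representation has norm at most ε / 2 on `x`, and their supremum is the norm of
  -- `x`.
  obtain ⟨x, hx⟩ := denseRange_minOf.exists_dist_lt d (half_pos hε)
  rw [dist_eq_norm] at hx
  have h1 : ‖minOf A B x‖ ≤ ε / 2 := by
    rw [norm_minOf]
    refine minSeminorm_le (half_pos hε).le fun π ρ => ?_
    rw [← norm_tensorHilbertRep, ← minTensorRep_minOf]
    have h2 : minTensorRep π.rep ρ.rep (minOf A B x) =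
        -minTensorRep π.rep ρ.rep (d - minOf A B x) := by
      rw [map_sub, h (π, ρ), zero_sub, neg_neg]
    calc ‖minTensorRep π.rep ρ.rep (minOf A B x)‖
        = ‖minTensorRep π.rep ρ.rep (d - minOf A B x)‖ := by
          rw [h2]; exact ContinuousLinearMap.opNorm_neg _
      _ ≤ ‖d - minOf A B x‖ := NonUnitalStarAlgHom.norm_apply_le (minTensorRep π.rep ρ.rep) _
      _ ≤ ε / 2 := hx.le
  calc ‖d‖ = ‖(d - minOf A B x) + minOf A B x‖ := by rw [sub_add_cancel]
    _ ≤ ε / 2 + ε / 2 := (norm_add_le _ _).trans (add_le_add hx.le h1)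
    _ = 0 + ε := by ring

/-- The flip H ⊗ K → K ⊗ H is an isometric bijection intertwining the two operators. This transfers
`norm_tensorRep_le_of_separating`, stated for the first factor, to the second. -/
theorem norm_tensorRep_comm (x : A ⊗[ℂ] B) :
    ‖tensorRep ρ π (TensorProduct.comm ℂ A B x)‖ = ‖tensorRep π ρ x‖ := by
  have key : ∀ v, tensorRep ρ π (TensorProduct.comm ℂ A B x) (TensorProduct.comm ℂ H K v) =
      TensorProduct.comm ℂ H K (tensorRep π ρ x v) := fun v => by
    induction x using TensorProduct.induction_on with
    | zero => simp
    | add x y hx hy => rw [map_add, map_add, map_add, add_apply, add_apply, map_add, hx, hy]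
    | tmul a b =>
      rw [TensorProduct.comm_tmul, tensorRep_tmul, tensorRep_tmul]
      induction v using TensorProduct.induction_on with
      | zero => simp
      | add v w hv hw => simp only [map_add, hv, hw]
      | tmul h k => simp
  refine le_antisymm ?_ ?_
  · refine ContinuousLinearMap.opNorm_le_bound _ (ContinuousLinearMap.opNorm_nonneg _) fun v => ?_
    obtain ⟨v, rfl⟩ := (TensorProduct.comm ℂ H K).surjective v
    rw [key, TensorProduct.norm_comm, TensorProduct.norm_comm]
    exact ContinuousLinearMap.le_opNorm _ _
  · refine ContinuousLinearMap.opNorm_le_bound _ (ContinuousLinearMap.opNorm_nonneg _) fun v => ?_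
    rw [← TensorProduct.norm_comm, ← key, ← TensorProduct.norm_comm v]
    exact ContinuousLinearMap.le_opNorm _ _

end MinTensorRep

/-! ### Associativity of the minimal tensor product -/

/-- Operators that agree on a common dense subspace of their domains, up to isometries, have the
same norm; here one inequality. -/
theorem ContinuousLinearMap.opNorm_tensor_le_of_isometry {X E E' F F' : Type*}
    [NormedAddCommGroup E] [InnerProductSpace ℂ E] [NormedAddCommGroup F] [InnerProductSpace ℂ F]
    [NormedAddCommGroup E'] [InnerProductSpace ℂ E']
    [NormedAddCommGroup F'] [InnerProductSpace ℂ F']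
    (S : E ⊗[ℂ] E' →L[ℂ] E ⊗[ℂ] E') (T : F ⊗[ℂ] F' →L[ℂ] F ⊗[ℂ] F') (I : X → E ⊗[ℂ] E')
    (J : X → F ⊗[ℂ] F') (hI : DenseRange I) (hIJ : ∀ v, ‖I v‖ = ‖J v‖)
    (h : ∀ v, ∃ z, S (I v) = I z ∧ T (J v) = J z) : ‖S‖ ≤ ‖T‖ := by
  refine ContinuousLinearMap.opNorm_le_bound _ (ContinuousLinearMap.opNorm_nonneg _) fun w => ?_
  refine hI.induction_on (p := fun w => ‖S w‖ ≤ ‖T‖ * ‖w‖) w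
    (isClosed_le (by fun_prop) (by fun_prop)) fun v => ?_
  obtain ⟨z, h1, h2⟩ := h v
  rw [h1, hIJ, hIJ, ← h2]
  exact T.le_opNorm _

/-- The closure of the range of a linear map is a subspace, so elementary tensors suffice. -/
theorem denseRange_of_tmul_mem {X E F : Type*} [AddCommGroup X] [Module ℂ X]
    [NormedAddCommGroup E] [InnerProductSpace ℂ E] [NormedAddCommGroup F] [InnerProductSpace ℂ F]
    (I : X →ₗ[ℂ] E ⊗[ℂ] F) (h : ∀ a b, a ⊗ₜ b ∈ closure (Set.range I)) : DenseRange I := by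
  intro x
  have hr : Set.range I = (LinearMap.range I : Set (E ⊗[ℂ] F)) := rfl
  rw [hr, ← Submodule.topologicalClosure_coe] at *
  induction x using TensorProduct.induction_on with
  | zero => exact zero_mem _
  | add x y hx hy => exact add_mem hx hy
  | tmul a b => exact h a b

section Assoc

open UniformSpace

variable {H K L : Type u} [NormedAddCommGroup H] [InnerProductSpace ℂ H]
  [NormedAddCommGroup K] [InnerProductSpace ℂ K] [NormedAddCommGroup L] [InnerProductSpace ℂ L]

variable (H K L) in
/-- The isometric embedding `(H ⊗ K) ⊗ L → (H ⊗ K)^ ⊗ L`. -/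
def complLeft : (H ⊗[ℂ] K) ⊗[ℂ] L →ₗᵢ[ℂ] Completion (H ⊗[ℂ] K) ⊗[ℂ] L :=
  LinearIsometry.rTensor L Completion.toComplₗᵢ

variable (H K L) in
/-- The isometric embedding `(H ⊗ K) ⊗ L → H ⊗ (K ⊗ L)^`. -/
def complRight : (H ⊗[ℂ] K) ⊗[ℂ] L →ₗᵢ[ℂ] H ⊗[ℂ] Completion (K ⊗[ℂ] L) :=
  (LinearIsometry.lTensor H Completion.toComplₗᵢ).comp
    (TensorProduct.assocIsometry ℂ H K L).toLinearIsometry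

theorem complLeft_tmul (v : H ⊗[ℂ] K) (l : L) : complLeft H K L (v ⊗ₜ l) = (v : Completion _) ⊗ₜ l :=
  rfl

theorem complRight_tmul (h : H) (k : K) (l : L) :
    complRight H K L (h ⊗ₜ k ⊗ₜ l) = h ⊗ₜ ((k ⊗ₜ[ℂ] l : K ⊗[ℂ] L) : Completion _) := rfl

theorem denseRange_complLeft : DenseRange (complLeft H K L) := by
  refine denseRange_of_tmul_mem (complLeft H K L).toLinearMap fun a l => ?_
  refine Completion.induction_on a ?_ fun v => subset_closure ⟨v ⊗ₜ l, rfl⟩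
  exact isClosed_closure.preimage
    (f := fun a => a ⊗ₜ[ℂ] l) (TensorProduct.continuous_tmul.comp (by fun_prop : Continuous
      fun a : Completion (H ⊗[ℂ] K) => (a, l)))

theorem denseRange_complRight : DenseRange (complRight H K L) := by
  refine denseRange_of_tmul_mem (complRight H K L).toLinearMap fun h a => ?_
  refine Completion.induction_on a ?_ fun v => subset_closure
    ⟨(TensorProduct.assoc ℂ H K L).symm (h ⊗ₜ v), ?_⟩
  · have hc : Continuous fun a : Completion (K ⊗[ℂ] L) => h ⊗ₜ[ℂ] a :=
      (TensorProduct.mkL ℂ H (Completion (K ⊗[ℂ] L)) h).continuous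
    exact isClosed_closure.preimage hc
  · induction v using TensorProduct.induction_on with
    | zero =>
      rw [TensorProduct.tmul_zero, LinearEquiv.map_zero, Completion.coe_zero,
        TensorProduct.tmul_zero]
      exact (complRight H K L).map_zero
    | add v w hv hw =>
      rw [TensorProduct.tmul_add, map_add, map_add, hv, hw, Completion.coe_add,
        TensorProduct.tmul_add]
    | tmul k l => rfl

variable [CompleteSpace H] [CompleteSpace K] [CompleteSpace L]
  {A B C : Type u} [CStarAlgebra A] [CStarAlgebra B] [CStarAlgebra C]

variable (A B C) in
/-- The canonical map `(A ⊗ B) ⊗ C → (A ⊗ B) ⊗ C` from the algebraic to the minimal tensor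
product. -/
def minOfLeft : (A ⊗[ℂ] B) ⊗[ℂ] C →⋆ₐ[ℂ] MinTensor (MinTensor A B) C :=
  (minOf (MinTensor A B) C).comp (StarAlgHom.tensorMap (minOf A B) (StarAlgHom.id ℂ C))

variable (A B C) in
/-- The canonical map `(A ⊗ B) ⊗ C → A ⊗ (B ⊗ C)` from the algebraic to the minimal tensor
product. -/
def minOfRight : (A ⊗[ℂ] B) ⊗[ℂ] C →⋆ₐ[ℂ] MinTensor A (MinTensor B C) :=
  (minOf A (MinTensor B C)).comp ((StarAlgHom.tensorMap (StarAlgHom.id ℂ A) (minOf B C)).comp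
    (StarAlgHom.tensorAssoc A B C))

theorem denseRange_minOfLeft : DenseRange (minOfLeft A B C) := by
  refine dense_of_minTmul_mem (LinearMap.range (minOfLeft A B C).toAlgHom.toLinearMap)
    fun d c => ?_
  refine denseRange_minOf.induction_on
    (p := fun d => minTmul d c ∈ closure (Set.range (minOfLeft A B C))) d ?_ ?_
  · exact isClosed_closure.preimage (continuous_minTmul_left c)
  · exact fun x => subset_closure ⟨x ⊗ₜ c, rfl⟩

theorem denseRange_minOfRight : DenseRange (minOfRight A B C) := by
  refine dense_of_minTmul_mem (LinearMap.range (minOfRight A B C).toAlgHom.toLinearMap)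
    fun a d => ?_
  refine denseRange_minOf.induction_on
    (p := fun d => minTmul a d ∈ closure (Set.range (minOfRight A B C))) d ?_ ?_
  · exact isClosed_closure.preimage (continuous_minTmul_right a)
  · refine fun x => subset_closure ⟨(TensorProduct.assoc ℂ A B C).symm (a ⊗ₜ x), ?_⟩
    induction x using TensorProduct.induction_on with
    | zero => simp [← minOf_tmul]
    | add v w hv hw =>
      rw [TensorProduct.tmul_add, map_add, map_add, hv, hw, map_add, minTmul_add]
    | tmul b c => rfl

variable (π : A →⋆ₐ[ℂ] (H →L[ℂ] H)) (ρ : B →⋆ₐ[ℂ] (K →L[ℂ] K)) (σ : C →⋆ₐ[ℂ] (L →L[ℂ] L))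

/-- The two triple product representations agree on the algebraic tensor product. -/
theorem exists_tensorRep_triple (x : (A ⊗[ℂ] B) ⊗[ℂ] C) (v : (H ⊗[ℂ] K) ⊗[ℂ] L) :
    ∃ z, tensorRep (minTensorRep π ρ) σ (StarAlgHom.tensorMap (minOf A B) (StarAlgHom.id ℂ C) x)
          (complLeft H K L v) = complLeft H K L z ∧
      tensorRep π (minTensorRep ρ σ) (StarAlgHom.tensorMap (StarAlgHom.id ℂ A) (minOf B C)
          (StarAlgHom.tensorAssoc A B C x)) (complRight H K L v) = complRight H K L z := by
  have hl : complLeft H K L 0 = 0 := LinearIsometry.map_zero _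
  have hr : complRight H K L 0 = 0 := LinearIsometry.map_zero _
  -- The witness `z` is the value of the common operator on (H ⊗ K) ⊗ L. Witnesses add up in `x` and
  -- in `v`, which reduces the claim to elementary tensors.
  induction x using TensorProduct.induction_on with
  | zero => exact ⟨0, by simp [hl, hr]⟩
  | add x y hx hy =>
    obtain ⟨z, h1, h2⟩ := hx
    obtain ⟨w, h3, h4⟩ := hy
    exact ⟨z + w, by simp only [map_add, add_apply, h1, h3], by
      simp only [map_add, add_apply, h2, h4]⟩
  | tmul x c =>
    induction x using TensorProduct.induction_on with
    | zero => exact ⟨0, by simp [hl, hr]⟩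
    | add x y hx hy =>
      obtain ⟨z, h1, h2⟩ := hx
      obtain ⟨w, h3, h4⟩ := hy
      exact ⟨z + w, by simp only [TensorProduct.add_tmul, map_add, add_apply, h1, h3], by
        simp only [TensorProduct.add_tmul, map_add, add_apply, h2, h4]⟩
    | tmul a b =>
      induction v using TensorProduct.induction_on with
      | zero => exact ⟨0, by simp [hl, hr]⟩
      | add x y hx hy =>
        obtain ⟨z, h1, h2⟩ := hx
        obtain ⟨w, h3, h4⟩ := hy
        exact ⟨z + w, by simp only [map_add, h1, h3], by simp only [map_add, h2, h4]⟩
      | tmul v l =>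
        induction v using TensorProduct.induction_on with
        | zero => exact ⟨0, by simp [hl, hr]⟩
        | add x y hx hy =>
          obtain ⟨z, h1, h2⟩ := hx
          obtain ⟨w, h3, h4⟩ := hy
          exact ⟨z + w, by simp only [TensorProduct.add_tmul, map_add, h1, h3], by
            simp only [TensorProduct.add_tmul, map_add, h2, h4]⟩
        | tmul h k =>
          refine ⟨(π a h ⊗ₜ ρ b k) ⊗ₜ σ c l, ?_, ?_⟩
          · rw [complLeft_tmul, complLeft_tmul, StarAlgHom.tensorMap_tmul, tensorRep_tmul,
              TensorProduct.mapL_tmul, minTensorRep_minOf, tensorHilbertRep_apply_coe,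
              tensorRep_tmul, TensorProduct.mapL_tmul]
            rfl
          · rw [complRight_tmul, complRight_tmul, StarAlgHom.tensorAssoc_tmul,
              StarAlgHom.tensorMap_tmul, tensorRep_tmul,
              TensorProduct.mapL_tmul, minTensorRep_minOf, tensorHilbertRep_apply_coe,
              tensorRep_tmul, TensorProduct.mapL_tmul]
            rfl

/-- Both operators restrict to the same operator on (H ⊗ K) ⊗ L, which embeds isometrically and
densely in both spaces; a bounded operator has the same norm on a dense subspace. -/
theorem norm_tensorRep_triple (x : (A ⊗[ℂ] B) ⊗[ℂ] C) :
    ‖tensorRep (minTensorRep π ρ) σ (StarAlgHom.tensorMap (minOf A B) (StarAlgHom.id ℂ C) x)‖ =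
      ‖tensorRep π (minTensorRep ρ σ) (StarAlgHom.tensorMap (StarAlgHom.id ℂ A) (minOf B C)
          (StarAlgHom.tensorAssoc A B C x))‖ := by
  have h := exists_tensorRep_triple π ρ σ x
  have hn : ∀ v, ‖complLeft H K L v‖ = ‖complRight H K L v‖ := fun v =>
    ((complLeft H K L).norm_map v).trans ((complRight H K L).norm_map v).symm
  refine le_antisymm ?_ ?_
  · exact ContinuousLinearMap.opNorm_tensor_le_of_isometry _ _ _ _
      denseRange_complLeft hn h
  · refine ContinuousLinearMap.opNorm_tensor_le_of_isometry _ _ _ _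
      denseRange_complRight (fun v => (hn v).symm) fun v => ?_
    obtain ⟨z, h1, h2⟩ := h v
    exact ⟨z, h2, h1⟩

/-- The outer supremum runs over all representations of the inner tensor product. Since product
representations separate its points, it is enough to bound those, and they regroup by
`norm_tensorRep_triple`. -/
theorem norm_minOfLeft_eq (x : (A ⊗[ℂ] B) ⊗[ℂ] C) :
    ‖minOfLeft A B C x‖ = ‖minOfRight A B C x‖ := by
  refine le_antisymm ?_ ?_
  · rw [minOfLeft, StarAlgHom.comp_apply, norm_minOf]
    refine minSeminorm_le (norm_nonneg _) fun θ σ => ?_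
    refine norm_tensorRep_le_of_separating
      (fun i : HilbertRep A × HilbertRep B => minTensorRep i.1.rep i.2.rep)
      eq_zero_of_minTensorRep θ.rep σ.rep _ (norm_nonneg _) fun i => ?_
    refine (norm_tensorRep_triple i.1.rep i.2.rep σ.rep x).le.trans ?_
    rw [minOfRight, StarAlgHom.comp_apply, norm_minOf]
    exact norm_tensorRep_le_minSeminorm _ _ _
  · rw [minOfRight, StarAlgHom.comp_apply, norm_minOf]
    refine minSeminorm_le (norm_nonneg _) fun π θ => ?_
    -- Here the inner tensor product is the second factor, so the flip brings it to the front.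
    rw [← norm_tensorRep_comm]
    refine norm_tensorRep_le_of_separating
      (fun i : HilbertRep B × HilbertRep C => minTensorRep i.1.rep i.2.rep)
      eq_zero_of_minTensorRep θ.rep π.rep _ (norm_nonneg _) fun i => ?_
    rw [norm_tensorRep_comm]
    refine (norm_tensorRep_triple π.rep i.1.rep i.2.rep x).ge.trans ?_
    rw [minOfLeft, StarAlgHom.comp_apply, norm_minOf]
    exact norm_tensorRep_le_minSeminorm _ _ _

variable (A B C) in
/-- The minimal tensor product is associative. -/
theorem exists_minTensor_assoc :
    ∃ assoc : MinTensor (MinTensor A B) C ≃⋆ₐ[ℂ] MinTensor A (MinTensor B C),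
      ∀ a b c, assoc (minTmul (minTmul a b) c) = minTmul a (minTmul b c) := by
  obtain ⟨φ, hφ⟩ := StarAlgHom.exists_starAlgEquiv (minOfLeft A B C) (minOfRight A B C)
    denseRange_minOfLeft denseRange_minOfRight norm_minOfLeft_eq
  exact ⟨φ, fun a b c => hφ (a ⊗ₜ b ⊗ₜ c)⟩

end Assoc

/-! ### The universal property of `SU_q(2)` -/

namespace FreeStarAlg

variable {X : Type*} [CStarAlgebra X] (a c : X)

/-- The image of a letter under the substitution of `a` and `c` for the free generators. -/
def letter (y : Fin 2 × Bool) : X :=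
  if y.2 then star (![a, c] y.1) else ![a, c] y.1

theorem star_letter (y : Fin 2 × Bool) : star (letter a c y) = letter a c (y.1, !y.2) := by
  obtain ⟨i, b⟩ := y
  cases b <;> simp [letter]

/-- The underlying algebra homomorphism of the substitution of `a` and `c` for the free
generators. -/
def liftAlgHom : FreeStarAlg →ₐ[ℂ] X :=
  MonoidAlgebra.lift ℂ X (FreeMonoid (Fin 2 × Bool)) (FreeMonoid.lift (letter a c))

theorem liftAlgHom_term (r : ℂ) (m : FreeMonoid (Fin 2 × Bool)) :
    liftAlgHom a c (term r m) = r • FreeMonoid.lift (letter a c) m :=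
  MonoidAlgebra.lift_single ..

theorem lift_wordStar (m : FreeMonoid (Fin 2 × Bool)) :
    FreeMonoid.lift (letter a c) (wordStar m) = star (FreeMonoid.lift (letter a c) m) := by
  induction m using FreeMonoid.recOn with
  | one => exact (star_one X).symm
  | of_mul x xs ih =>
    have hx : wordStar (FreeMonoid.of x) = FreeMonoid.of (x.1, !x.2) := rfl
    rw [wordStar_mul, map_mul, map_mul, star_mul, ih, hx, FreeMonoid.lift_eval_of,
      FreeMonoid.lift_eval_of, star_letter]

/-- The substitution of `a` and `c` for the free generators. -/
def lift : FreeStarAlg →⋆ₐ[ℂ] X where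
  __ := liftAlgHom a c
  map_star' f := by
    refine induction (P := fun f => liftAlgHom a c (star f) = star (liftAlgHom a c f)) f ?_ ?_ ?_
    · rw [star_zero, map_zero, star_zero]
    · intro x y hx hy; rw [star_add, map_add, map_add, star_add, hx, hy]
    · intro r m
      rw [star_term, liftAlgHom_term, liftAlgHom_term, lift_wordStar, star_smul]
      rfl

theorem lift_gen (i : Fin 2) : lift a c (gen i) = ![a, c] i := by
  refine (liftAlgHom_term a c 1 _).trans ?_
  rw [one_smul, FreeMonoid.lift_eval_of]
  rfl

/-- A subalgebra containing the generators and their adjoints is everything. -/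
theorem mem_of_gen_mem (S : Subalgebra ℂ FreeStarAlg) (h : ∀ i, gen i ∈ S)
    (h' : ∀ i, star (gen i) ∈ S) (x : FreeStarAlg) : x ∈ S := by
  refine induction (P := fun x => x ∈ S) x (zero_mem S) (fun x y => add_mem) fun r m => ?_
  have hm : term 1 m ∈ S := by
    induction m using FreeMonoid.recOn with
    | one => exact one_mem S
    | of_mul y ys ih =>
      have hy : term 1 (FreeMonoid.of y) ∈ S := by
        obtain ⟨i, b⟩ := y
        cases b
        · exact h i
        · rw [← star_gen]; exact h' i
      have h2 : term 1 (FreeMonoid.of y * ys) = term 1 (FreeMonoid.of y) * term 1 ys := by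
        rw [term_mul, one_mul]
      rw [h2]
      exact mul_mem hy ih
  have h3 : term r m = r • term 1 m := by rw [smul_term, mul_one]
  rw [h3]
  exact S.smul_mem hm r

end FreeStarAlg

theorem suMatrix_map {B C : Type*} [Ring B] [StarRing B] [Algebra ℂ B] [Ring C] [StarRing C]
    [Algebra ℂ C] (φ : B →⋆ₐ[ℂ] C) (q : ℝ) (a c : B) :
    (suMatrix q a c).map φ = suMatrix q (φ a) (φ c) := by
  ext i j
  fin_cases i <;> fin_cases j <;> simp [suMatrix, map_star, -Complex.coe_smul]

theorem Matrix.conjTranspose_map_starAlgHom {B C : Type*} [Ring B] [StarRing B] [Algebra ℂ B]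
    [Ring C] [StarRing C] [Algebra ℂ C] (φ : B →⋆ₐ[ℂ] C) (U : Matrix (Fin 2) (Fin 2) B) :
    (U.map φ).conjTranspose = U.conjTranspose.map φ := by
  ext i j
  simp [map_star]

theorem Matrix.map_starAlgHom_mul {B C : Type*} [Ring B] [StarRing B] [Algebra ℂ B]
    [Ring C] [StarRing C] [Algebra ℂ C] (φ : B →⋆ₐ[ℂ] C) (U V : Matrix (Fin 2) (Fin 2) B) :
    (U * V).map φ = U.map φ * V.map φ :=
  Matrix.map_mul (f := (φ : B →+* C))

theorem Matrix.map_starAlgHom_one {B C : Type*} [Ring B] [StarRing B] [Algebra ℂ B]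
    [Ring C] [StarRing C] [Algebra ℂ C] (φ : B →⋆ₐ[ℂ] C) :
    (1 : Matrix (Fin 2) (Fin 2) B).map φ = 1 :=
  Matrix.map_one φ (map_zero φ) (map_one φ)

namespace SUq

open FreeStarAlg

variable (q : ℝ)

/-- The canonical map from the free *-algebra to `SU_q(2)`. -/
def ofFree : FreeStarAlg →⋆ₐ[ℂ] SUq q :=
  (CStarSeminorm.sup (suSeminorms q) (suSeminorms_bounded q)).ofHom

theorem ofFree_gen_zero : ofFree q (gen 0) = α q := rfl

theorem ofFree_gen_one : ofFree q (gen 1) = γ q := rfl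

theorem denseRange_ofFree : DenseRange (ofFree q) := CStarSeminorm.denseRange_ofHom _

theorem norm_ofFree (x : FreeStarAlg) :
    ‖ofFree q x‖ = CStarSeminorm.sup (suSeminorms q) (suSeminorms_bounded q) x :=
  CStarSeminorm.norm_of _ x

/-- The fundamental unitary matrix of `SU_q(2)`. -/
def fundamental : Matrix (Fin 2) (Fin 2) (SUq q) := suMatrix q (α q) (γ q)

theorem fundamental_eq : fundamental q = (suMatrix q (gen 0) (gen 1)).map (ofFree q) :=
  (suMatrix_map (ofFree q) q _ _).symm

/-- Each relation is null for every seminorm in the family, hence for the supremum, hence zero in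
the completion. -/
theorem conjTranspose_mul_fundamental : (fundamental q).conjTranspose * fundamental q = 1 := by
  rw [← sub_eq_zero, fundamental_eq, Matrix.conjTranspose_map_starAlgHom,
    ← Matrix.map_starAlgHom_mul, ← Matrix.map_starAlgHom_one (ofFree q),
    ← Matrix.map_sub _ (map_sub (ofFree q))]
  ext i j
  rw [Matrix.map_apply, Matrix.zero_apply, ← norm_le_zero_iff, norm_ofFree]
  exact CStarSeminorm.sup_le _ le_rfl fun p hp => (hp i j).1.le

theorem fundamental_mul_conjTranspose : fundamental q * (fundamental q).conjTranspose = 1 := by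
  rw [← sub_eq_zero, fundamental_eq, Matrix.conjTranspose_map_starAlgHom,
    ← Matrix.map_starAlgHom_mul, ← Matrix.map_starAlgHom_one (ofFree q),
    ← Matrix.map_sub _ (map_sub (ofFree q))]
  ext i j
  rw [Matrix.map_apply, Matrix.zero_apply, ← norm_le_zero_iff, norm_ofFree]
  exact CStarSeminorm.sup_le _ le_rfl fun p hp => (hp i j).2.le

variable {q}

/-- The universal property of `SU_q(2)`. -/
theorem exists_lift {X : Type*} [CStarAlgebra X] (a c : X)
    (h1 : (suMatrix q a c).conjTranspose * suMatrix q a c = 1)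
    (h2 : suMatrix q a c * (suMatrix q a c).conjTranspose = 1) :
    ∃ φ : SUq q →⋆ₐ[ℂ] X, φ (α q) = a ∧ φ (γ q) = c := by
  have hU : (suMatrix q (gen 0) (gen 1)).map (lift a c) = suMatrix q a c := by
    rw [suMatrix_map, lift_gen, lift_gen]; rfl
  -- The relations for `a` and `c` say that x ↦ ‖lift a c x‖ is an admissible seminorm. It is
  -- therefore dominated by the universal one, and the substitution descends.
  have hp : CStarSeminorm.ofStarAlgHom (lift a c) ∈ suSeminorms q := fun i j => by
    rw [CStarSeminorm.ofStarAlgHom_apply, CStarSeminorm.ofStarAlgHom_apply, norm_eq_zero,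
      norm_eq_zero, ← Matrix.map_apply (f := lift a c), ← Matrix.map_apply (f := lift a c),
      Matrix.map_sub _ (map_sub (lift a c)), Matrix.map_sub _ (map_sub (lift a c)),
      Matrix.map_starAlgHom_mul, Matrix.map_starAlgHom_mul,
      ← Matrix.conjTranspose_map_starAlgHom, hU, Matrix.map_starAlgHom_one, h1, h2, sub_self]
    exact ⟨rfl, rfl⟩
  obtain ⟨φ, hφ⟩ := StarAlgHom.exists_extension (ofFree q) (lift a c) (denseRange_ofFree q)
    fun x => by
      rw [norm_ofFree, ← CStarSeminorm.ofStarAlgHom_apply]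
      exact CStarSeminorm.le_sup _ hp x
  refine ⟨φ, ?_, ?_⟩
  · rw [← ofFree_gen_zero, hφ, lift_gen]; rfl
  · rw [← ofFree_gen_one, hφ, lift_gen]; rfl

/-- A subalgebra of `SU_q(2)` containing the generators and their adjoints is dense. -/
theorem dense_of_mem (S : Subalgebra ℂ (SUq q)) (h0 : α q ∈ S) (h1 : γ q ∈ S)
    (h2 : star (α q) ∈ S) (h3 : star (γ q) ∈ S) : Dense (S : Set (SUq q)) := by
  refine (denseRange_ofFree q).mono ?_
  rintro _ ⟨x, rfl⟩
  refine mem_of_gen_mem (S.comap (ofFree q).toAlgHom) ?_ ?_ x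
  · rw [Fin.forall_fin_two]
    exact ⟨h0, h1⟩
  · rw [Fin.forall_fin_two]
    refine ⟨?_, ?_⟩
    · change ofFree q (star (gen 0)) ∈ S
      rw [map_star]; exact h2
    · change ofFree q (star (gen 1)) ∈ S
      rw [map_star]; exact h3

/-- *-homomorphisms on `SU_q(2)` are determined by their values on the generators. -/
theorem hom_ext {X : Type*} [CStarAlgebra X] {φ ψ : SUq q →⋆ₐ[ℂ] X} (h0 : φ (α q) = ψ (α q))
    (h1 : φ (γ q) = ψ (γ q)) : φ = ψ := by
  have hd := dense_of_mem (AlgHom.equalizer φ.toAlgHom ψ.toAlgHom) h0 h1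
    ((map_star φ _).trans ((congrArg star h0).trans (map_star ψ _).symm))
    ((map_star φ _).trans ((congrArg star h1).trans (map_star ψ _).symm))
  exact StarAlgHom.ext_of_denseRange (f := ((↑) : AlgHom.equalizer φ.toAlgHom ψ.toAlgHom → SUq q))
    hd.denseRange_val fun x => x.2

variable (q)

/-! ### The comultiplication -/

/-- This is the source of the formulas for Δ. Agreement of the first columns is their definition; in
the second column it rests on q being real, as adjoints of the first-column entries appear there. -/
theorem comulMatrix_eq :
    suMatrix q (minTmul (α q) (α q) - (q : ℂ) • minTmul (star (γ q)) (γ q))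
        (minTmul (γ q) (α q) + minTmul (star (α q)) (γ q)) =
      (fundamental q).map (minInclLeft (SUq q) (SUq q)) *
        (fundamental q).map (minInclRight (SUq q) (SUq q)) := by
  ext i j
  fin_cases i <;> fin_cases j <;>
    simp [suMatrix, fundamental, Matrix.mul_apply, minInclLeft_mul_minInclRight, star_minTmul,
      sub_eq_add_neg, minTmul_neg, neg_minTmul, minTmul_smul, smul_minTmul,
      -Complex.coe_smul]
  all_goals abel

/-- U ⊗ 1 and 1 ⊗ U are images of the unitary U under *-homomorphisms, so their product is unitary
and the universal property applies. -/
theorem exists_comul : ∃ Δ : SUq q →⋆ₐ[ℂ] MinTensor (SUq q) (SUq q),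
    Δ (α q) = minTmul (α q) (α q) - (q : ℂ) • minTmul (star (γ q)) (γ q) ∧
    Δ (γ q) = minTmul (γ q) (α q) + minTmul (star (α q)) (γ q) := by
  refine exists_lift _ _ ?_ ?_
  · rw [comulMatrix_eq, Matrix.conjTranspose_mul, Matrix.mul_assoc,
      ← Matrix.mul_assoc ((fundamental q).map (minInclLeft _ _)).conjTranspose,
      Matrix.conjTranspose_map_starAlgHom, Matrix.conjTranspose_map_starAlgHom,
      ← Matrix.map_starAlgHom_mul, conjTranspose_mul_fundamental, Matrix.map_starAlgHom_one,
      Matrix.one_mul, ← Matrix.map_starAlgHom_mul, conjTranspose_mul_fundamental,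
      Matrix.map_starAlgHom_one]
  · rw [comulMatrix_eq, Matrix.conjTranspose_mul, Matrix.mul_assoc,
      ← Matrix.mul_assoc ((fundamental q).map (minInclRight _ _)),
      Matrix.conjTranspose_map_starAlgHom, Matrix.conjTranspose_map_starAlgHom,
      ← Matrix.map_starAlgHom_mul, fundamental_mul_conjTranspose, Matrix.map_starAlgHom_one,
      Matrix.one_mul, ← Matrix.map_starAlgHom_mul, fundamental_mul_conjTranspose,
      Matrix.map_starAlgHom_one]

variable {q}

/-- It suffices to compare on α and γ, where both sides expand to the same sum of triple elementary
tensors. -/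
theorem isCoassociative_of_apply (Δ : SUq q →⋆ₐ[ℂ] MinTensor (SUq q) (SUq q))
    (hα : Δ (α q) = minTmul (α q) (α q) - (q : ℂ) • minTmul (star (γ q)) (γ q))
    (hγ : Δ (γ q) = minTmul (γ q) (α q) + minTmul (star (α q)) (γ q)) : IsCoassociative Δ := by
  obtain ⟨Δid, h1⟩ := exists_minTensor_map Δ (StarAlgHom.id ℂ (SUq q))
  obtain ⟨idΔ, h2⟩ := exists_minTensor_map (StarAlgHom.id ℂ (SUq q)) Δ
  obtain ⟨assoc, h3⟩ := exists_minTensor_assoc (SUq q) (SUq q) (SUq q)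
  refine ⟨Δid, idΔ, assoc, h1, h2, h3, fun a => ?_⟩
  have h : ((assoc : MinTensor (MinTensor (SUq q) (SUq q)) (SUq q) →⋆ₐ[ℂ] _).comp Δid).comp Δ =
      idΔ.comp Δ := by
    refine hom_ext ?_ ?_
    all_goals
      simp only [StarAlgHom.comp_apply, hα, hγ, map_add, map_sub, map_smul, h1, h2,
        StarAlgHom.coe_id, id_eq, map_star, star_add, star_sub, star_smul, star_minTmul, star_star,
        add_minTmul, sub_minTmul, smul_minTmul, minTmul_add, minTmul_sub, minTmul_smul, h3,
        StarAlgHom.coe_coe, smul_add, Complex.star_def, Complex.conj_ofReal]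
      abel
  exact DFunLike.congr_fun h a

end SUq

/-! ### Density -/

section Density

variable {A : Type u} {X : Type v} [CStarAlgebra A] [CStarAlgebra X] (Δ ι κ : A →⋆ₐ[ℂ] X)

/-- The elements `x` for which `ι x` lies in the linear span of the products `Δ a * κ b`. -/
def spanMulSubalgebra (hc : ∀ a b, ι a * κ b = κ b * ι a) : Subalgebra ℂ A where
  carrier := {x | ι x ∈ Submodule.span ℂ {y : X | ∃ a b, y = Δ a * κ b}}
  mul_mem' {x y} hx hy := by
    change ι (x * y) ∈ Submodule.span ℂ {y : X | ∃ a b, y = Δ a * κ b}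
    rw [map_mul]
    -- The span is stable under left multiplication by Δ(A) and right multiplication by κ(A). For a
    -- product, (Δ a κ b) ι y = Δ a (ι y) κ b because the legs commute, and then ι y is expanded
    -- inside.
    have hr : ∀ z ∈ Submodule.span ℂ {y : X | ∃ a b, y = Δ a * κ b}, ∀ a b,
        Δ a * z * κ b ∈ Submodule.span ℂ {y : X | ∃ a b, y = Δ a * κ b} := fun z hz a b => by
      induction hz using Submodule.span_induction with
      | zero => simp
      | add z w _ _ hz hw => rw [mul_add, add_mul]; exact add_mem hz hw
      | smul c z _ hz => rw [mul_smul_comm, smul_mul_assoc]; exact Submodule.smul_mem _ c hz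
      | mem z hz =>
        obtain ⟨a', b', rfl⟩ := hz
        refine Submodule.subset_span ⟨a * a', b' * b, ?_⟩
        rw [map_mul, map_mul, mul_assoc, mul_assoc, mul_assoc]
    suffices h : ∀ z ∈ Submodule.span ℂ {y : X | ∃ a b, y = Δ a * κ b},
        z * ι y ∈ Submodule.span ℂ {y : X | ∃ a b, y = Δ a * κ b} from h _ hx
    intro z hz
    induction hz using Submodule.span_induction with
    | zero => simp
    | add z w _ _ hz hw => rw [add_mul]; exact add_mem hz hw
    | smul c z _ hz => rw [smul_mul_assoc]; exact Submodule.smul_mem _ c hz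
    | mem z hz =>
      obtain ⟨a, b, rfl⟩ := hz
      rw [mul_assoc, ← hc, ← mul_assoc]
      exact hr _ hy a b
  add_mem' {x y} hx hy := by
    change ι (x + y) ∈ Submodule.span ℂ {y : X | ∃ a b, y = Δ a * κ b}
    rw [map_add]
    exact add_mem hx hy
  algebraMap_mem' r := by
    change ι (algebraMap ℂ A r) ∈ Submodule.span ℂ {y : X | ∃ a b, y = Δ a * κ b}
    rw [Algebra.algebraMap_eq_smul_one, map_smul, map_one]
    exact Submodule.smul_mem _ r (Submodule.subset_span ⟨1, 1, by simp⟩)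

theorem mem_spanMulSubalgebra (hc : ∀ a b, ι a * κ b = κ b * ι a) (x : A) :
    x ∈ spanMulSubalgebra Δ ι κ hc ↔ ι x ∈ Submodule.span ℂ {y : X | ∃ a b, y = Δ a * κ b} :=
  Iff.rfl

/-- If `ι x` lies in the span of the products `Δ a * κ b` for a dense set of `x`, then all products
`ι x * κ b` lie in its closure. -/
theorem mul_mem_closure_span (hc : ∀ a b, ι a * κ b = κ b * ι a)
    (hd : Dense (spanMulSubalgebra Δ ι κ hc : Set A)) (x b : A) :
    ι x * κ b ∈ closure (Submodule.span ℂ {y : X | ∃ a b, y = Δ a * κ b} : Set X) := by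
  have hcont : Continuous fun x => ι x * κ b :=
    ι.continuous_cstarAlgebra.mul continuous_const
  refine map_mem_closure (f := fun x => ι x * κ b) hcont (hd x) fun y hy => ?_
  rw [SetLike.mem_coe, mem_spanMulSubalgebra] at hy
  change ι y * κ b ∈ Submodule.span ℂ {y : X | ∃ a b, y = Δ a * κ b}
  generalize ι y = z at hy ⊢
  induction hy using Submodule.span_induction with
  | zero => simp
  | add z w _ _ hz hw => rw [add_mul]; exact add_mem hz hw
  | smul c z _ hz => rw [smul_mul_assoc]; exact Submodule.smul_mem _ c hz
  | mem z hz =>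
    obtain ⟨a, b', rfl⟩ := hz
    exact Submodule.subset_span ⟨a, b' * b, by rw [map_mul, mul_assoc]⟩

end Density

/-! ### Density conditions for SU_q(2) -/

namespace SUq

variable {q : ℝ}

/-- For `q ≠ 0`, a subalgebra containing the entries of the fundamental matrix is dense. -/
theorem dense_of_fundamental_mem (hq : q ≠ 0) (S : Subalgebra ℂ (SUq q))
    (h : ∀ i j, fundamental q i j ∈ S) : Dense (S : Set (SUq q)) := by
  refine dense_of_mem S (h 0 0) (h 1 0) (h 1 1) ?_
  -- The (0, 1) entry is -q γ*, so γ* is recovered by dividing by -q; at q = 0 this entry vanishes.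
  have h1 : star (γ q) = (-(q : ℂ)⁻¹) • fundamental q 0 1 := by
    have h2 : fundamental q 0 1 = -((q : ℂ) • star (γ q)) := rfl
    rw [h2, smul_neg, neg_smul, neg_neg, smul_smul,
      inv_mul_cancel₀ (Complex.ofReal_ne_zero.2 hq), one_smul]
  rw [h1]
  exact S.smul_mem (h 0 1) _

/-- For `q ≠ 0`, a subalgebra containing the adjoints of the entries of the fundamental matrix is
dense. -/
theorem dense_of_star_fundamental_mem (hq : q ≠ 0) (S : Subalgebra ℂ (SUq q))
    (h : ∀ i j, star (fundamental q i j) ∈ S) : Dense (S : Set (SUq q)) := by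
  refine dense_of_mem S ?_ ?_ (h 0 0) (h 1 0)
  · have := h 1 1
    rwa [show fundamental q 1 1 = star (α q) from rfl, star_star] at this
  · have h1 : γ q = (-(q : ℂ)⁻¹) • star (fundamental q 0 1) := by
      have h2 : fundamental q 0 1 = -((q : ℂ) • star (γ q)) := rfl
      rw [h2, star_neg, star_smul, star_star, Complex.star_def, Complex.conj_ofReal, smul_neg,
        neg_smul, neg_neg, smul_smul, inv_mul_cancel₀ (Complex.ofReal_ne_zero.2 hq), one_smul]
    rw [h1]
    exact S.smul_mem (h 0 1) _

theorem fundamental_map_comul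
    (Δ : SUq q →⋆ₐ[ℂ] MinTensor (SUq q) (SUq q))
    (hα : Δ (α q) = minTmul (α q) (α q) - (q : ℂ) • minTmul (star (γ q)) (γ q))
    (hγ : Δ (γ q) = minTmul (γ q) (α q) + minTmul (star (α q)) (γ q)) :
    (fundamental q).map Δ =
    (fundamental q).map (minInclLeft (SUq q) (SUq q)) *
      (fundamental q).map (minInclRight (SUq q) (SUq q)) := by
  rw [← comulMatrix_eq, ← hα, ← hγ, ← suMatrix_map]
  rfl

/-- Cancelling 1 ⊗ U on the right of Δ(U) = (U ⊗ 1)(1 ⊗ U) exhibits each U i j ⊗ 1 as a sum of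
products Δ(a)(1 ⊗ b). -/
theorem comul_mul_right
    (Δ : SUq q →⋆ₐ[ℂ] MinTensor (SUq q) (SUq q))
    (hα : Δ (α q) = minTmul (α q) (α q) - (q : ℂ) • minTmul (star (γ q)) (γ q))
    (hγ : Δ (γ q) = minTmul (γ q) (α q) + minTmul (star (α q)) (γ q)) :
    (fundamental q).map Δ *
    (fundamental q).conjTranspose.map (minInclRight (SUq q) (SUq q)) =
      (fundamental q).map (minInclLeft (SUq q) (SUq q)) := by
  rw [fundamental_map_comul Δ hα hγ, Matrix.mul_assoc, ← Matrix.map_starAlgHom_mul,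
    fundamental_mul_conjTranspose, Matrix.map_starAlgHom_one, Matrix.mul_one]

/-- Taking adjoints first, Δ(U*) = (1 ⊗ U*)(U* ⊗ 1), keeps Δ on the left while U* ⊗ 1 is cancelled.
The price is that entries of U* rather than of U are obtained, whence
`dense_of_star_fundamental_mem`. -/
theorem comul_mul_left
    (Δ : SUq q →⋆ₐ[ℂ] MinTensor (SUq q) (SUq q))
    (hα : Δ (α q) = minTmul (α q) (α q) - (q : ℂ) • minTmul (star (γ q)) (γ q))
    (hγ : Δ (γ q) = minTmul (γ q) (α q) + minTmul (star (α q)) (γ q)) :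
    (fundamental q).conjTranspose.map Δ *
    (fundamental q).map (minInclLeft (SUq q) (SUq q)) =
      (fundamental q).conjTranspose.map (minInclRight (SUq q) (SUq q)) := by
  rw [← Matrix.conjTranspose_map_starAlgHom, fundamental_map_comul Δ hα hγ,
    Matrix.conjTranspose_mul, Matrix.mul_assoc, Matrix.conjTranspose_map_starAlgHom,
    Matrix.conjTranspose_map_starAlgHom, ← Matrix.map_starAlgHom_mul,
    conjTranspose_mul_fundamental, Matrix.map_starAlgHom_one, Matrix.mul_one]

theorem isCompactQuantumGroup_of_apply
    (Δ : SUq q →⋆ₐ[ℂ] MinTensor (SUq q) (SUq q))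
    (hα : Δ (α q) = minTmul (α q) (α q) - (q : ℂ) • minTmul (star (γ q)) (γ q))
    (hγ : Δ (γ q) = minTmul (γ q) (α q) + minTmul (star (α q)) (γ q))
    (hq : q ≠ 0) : IsCompactQuantumGroup Δ where
  coassoc := isCoassociative_of_apply Δ hα hγ
  dense_right := by
    refine dense_of_minTmul_mem _ fun a b => ?_
    have hc : ∀ a b : SUq q, minInclLeft (SUq q) (SUq q) a * minInclRight (SUq q) (SUq q) b =
        minInclRight (SUq q) (SUq q) b * minInclLeft (SUq q) (SUq q) a := fun a b => by
      rw [minInclLeft_mul_minInclRight, minInclRight_mul_minInclLeft]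
    rw [← minInclLeft_mul_minInclRight]
    refine mul_mem_closure_span Δ _ _ hc (dense_of_fundamental_mem hq _ fun i j => ?_) a b
    rw [mem_spanMulSubalgebra, ← Matrix.map_apply (f := minInclLeft (SUq q) (SUq q)),
      ← comul_mul_right Δ hα hγ, Matrix.mul_apply]
    exact sum_mem fun k _ => Submodule.subset_span ⟨_, _, rfl⟩
  dense_left := by
    refine dense_of_minTmul_mem _ fun a b => ?_
    have hc : ∀ a b : SUq q, minInclRight (SUq q) (SUq q) a * minInclLeft (SUq q) (SUq q) b =
        minInclLeft (SUq q) (SUq q) b * minInclRight (SUq q) (SUq q) a := fun a b => by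
      rw [minInclLeft_mul_minInclRight, minInclRight_mul_minInclLeft]
    rw [← minInclRight_mul_minInclLeft]
    refine mul_mem_closure_span Δ _ _ hc (dense_of_star_fundamental_mem hq _ fun i j => ?_) b a
    rw [mem_spanMulSubalgebra, ← Matrix.conjTranspose_apply,
      ← Matrix.map_apply (f := minInclRight (SUq q) (SUq q)), ← comul_mul_left Δ hα hγ,
      Matrix.mul_apply]
    exact sum_mem fun k _ => Submodule.subset_span ⟨_, _, rfl⟩

end SUq

end

theorem mainTheorem2 (q : ℝ) (hq : q ∈ Set.Icc (0 : ℝ) 1) :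
    ∃ Δ : SUq q →⋆ₐ[ℂ] MinTensor (SUq q) (SUq q),
      Δ (SUq.α q) = minTmul (SUq.α q) (SUq.α q) -
        (q : ℂ) • minTmul (star (SUq.γ q)) (SUq.γ q) ∧
      Δ (SUq.γ q) = minTmul (SUq.γ q) (SUq.α q) + minTmul (star (SUq.α q)) (SUq.γ q) ∧
      IsCoassociative Δ ∧
      (0 < q → IsCompactQuantumGroup Δ) := by
  obtain ⟨Δ, hα, hγ⟩ := SUq.exists_comul q
  exact ⟨Δ, hα, hγ, SUq.isCoassociative_of_apply Δ hα hγ,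
    fun h => SUq.isCompactQuantumGroup_of_apply Δ hα hγ h.ne'⟩
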